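/- Let $D$ be the open unit disc, $T$ the unit circle with normalized Lebesgue measure $m$, and $1\le p<\infty$. Let $H^p$ be the space of analytic functions $f$ on $D$ with $\|f\|_p^p=\sup_{0<r<1}\int_T|f(r\zeta)|^p\,dm(\zeta)<\infty$. Let $\phi(z)=\lambda\frac{z-a}{1-\bar a z}$ (with $|\lambda|=1$, $a\in D$) and $\psi$ be holomorphic automorphisms of $D$, let $\phi_k$ be the $k$-fold composition of $\phi$ with itself ($\phi_0(z)=z$), and put $$ (U_\phi f)(z)=\bigl(\bar\lambda\,\phi'(z)\bigr)^{1/p} f(\phi(z)),\qquad (M_\psi f)(z)=\psi(z)f(z),\qquad S=M_\psi U_\phi, $$ where the power is the principal branch. Then $S$ is a linear isometry of $H^p$ into $H^p$ whose range has codimension one, each function $\psi\circ\phi_k$ ($k\ge 0$) has exactly one zero $a_k$ in $D$, and $S$ is Crownover, that is, $$\bigcap_{n=1}^\infty S^nH^p=\{0\},$$ if and only if $(a_k)_{k\ge0}$ is not a Blaschke sequence, that is, if and only if $\sum_{k=0}^\infty(1-|a_k|)=\infty$. -/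

import Mathlib

noncomputable section

open Complex Complex.UnitDisc
open scoped ComplexConjugate

namespace HardyIsometry

/-- Parameters `(lam, a)`, `|lam| = 1`, `|a| < 1`, of the disc automorphism
`z ↦ lam (z - a) / (1 - conj a * z)`. Every holomorphic automorphism of the disc arises from exactly
one such pair. -/
structure DiscAut where
  lam : Circle
  a : 𝔻

namespace DiscAut

/-- The formula of the automorphism, as a function on `ℂ`. -/
def formula (φ : DiscAut) (z : ℂ) : ℂ :=
  (φ.lam : ℂ) * (z - (φ.a : ℂ)) / (1 - conj (φ.a : ℂ) * z)

theorem norm_formula_lt_one (φ : DiscAut) (z : 𝔻) : ‖φ.formula (z : ℂ)‖ < 1 := by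
  have ha := φ.a.normSq_lt_one
  have hz := z.normSq_lt_one
  have key : normSq ((z : ℂ) - φ.a) < normSq (1 - conj (φ.a : ℂ) * z) := by
    have h : normSq (1 - conj (φ.a : ℂ) * z) - normSq ((z : ℂ) - φ.a)
        = (1 - normSq (φ.a : ℂ)) * (1 - normSq (z : ℂ)) := by
      simp only [normSq_apply, sub_re, sub_im, mul_re, mul_im, one_re, one_im, conj_re, conj_im]
      ring
    have := mul_pos (sub_pos.2 ha) (sub_pos.2 hz)
    linarith
  have h2 : ‖(z : ℂ) - φ.a‖ < ‖1 - conj (φ.a : ℂ) * z‖ := by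
    rw [normSq_eq_norm_sq, normSq_eq_norm_sq] at key
    exact lt_of_pow_lt_pow_left₀ 2 (norm_nonneg _) key
  rw [formula, norm_div, norm_mul, Circle.norm_coe, one_mul,
    div_lt_one ((norm_nonneg _).trans_lt h2)]
  exact h2

/-- The automorphism as a self-map of the disc. -/
def toMap (φ : DiscAut) (z : 𝔻) : 𝔻 :=
  UnitDisc.mk (φ.formula (z : ℂ)) (φ.norm_formula_lt_one z)

instance : CoeFun DiscAut (fun _ => 𝔻 → 𝔻) := ⟨toMap⟩

end DiscAut

/-- Extension by zero of a function on the disc to `ℂ`. -/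
def zeroExt (f : 𝔻 → ℂ) : ℂ → ℂ := Function.extend UnitDisc.coe f 0

/-- Analyticity of a function on the open unit disc. -/
def IsAnalytic (f : 𝔻 → ℂ) : Prop :=
  DifferentiableOn ℂ (zeroExt f) (Metric.ball 0 1)

/-- `∫_T |f(rζ)|^p dm(ζ)` with `m` the normalized Lebesgue measure on the unit circle. -/
def integralMean (p : ℝ) (f : 𝔻 → ℂ) (r : ℝ) : ℝ :=
  Real.circleAverage (fun z => ‖zeroExt f z‖ ^ p) 0 r

/-- Membership in the Hardy space: `f` is analytic and its integral means are bounded,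
`0 < r < 1`. -/
def MemHp (p : ℝ) (f : 𝔻 → ℂ) : Prop :=
  IsAnalytic f ∧ BddAbove (integralMean p f '' Set.Ioo 0 1)

/-- The Hardy space norm, `(sup_{0<r<1} ∫_T |f(rζ)|^p dm(ζ))^(1/p)`. -/
def hpNorm (p : ℝ) (f : 𝔻 → ℂ) : ℝ :=
  sSup (integralMean p f '' Set.Ioo 0 1) ^ (1 / p)

theorem zeroExt_coe (f : 𝔻 → ℂ) (z : 𝔻) : zeroExt f (z : ℂ) = f z :=
  UnitDisc.coe_injective.extend_apply f 0 z

theorem zeroExt_add (f g : 𝔻 → ℂ) (z : ℂ) : zeroExt (f + g) z = zeroExt f z + zeroExt g z := by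
  by_cases h : ∃ w : 𝔻, (w : ℂ) = z
  · obtain ⟨w, rfl⟩ := h
    simp [zeroExt_coe]
  · simp [zeroExt, Function.extend_apply' _ _ _ h]

theorem zeroExt_smul (c : ℂ) (f : 𝔻 → ℂ) (z : ℂ) : zeroExt (c • f) z = c * zeroExt f z := by
  by_cases h : ∃ w : 𝔻, (w : ℂ) = z
  · obtain ⟨w, rfl⟩ := h
    simp [zeroExt_coe]
  · simp [zeroExt, Function.extend_apply' _ _ _ h]

theorem IsAnalytic.circleIntegrable {p : ℝ} (hp : 0 ≤ p) {f : 𝔻 → ℂ} (hf : IsAnalytic f)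
    {r : ℝ} (hr : r ∈ Set.Ioo (0 : ℝ) 1) :
    CircleIntegrable (fun z => ‖zeroExt f z‖ ^ p) 0 r := by
  refine ContinuousOn.circleIntegrable hr.1.le ?_
  refine ContinuousOn.rpow_const ?_ (fun _ _ => Or.inr hp)
  refine (hf.continuousOn.mono ?_).norm
  exact Metric.sphere_subset_ball hr.2

/-- The Hardy space `H^p` of the disc, `1 ≤ p < ∞`, as a space of functions on the disc. -/
def Hp (p : ℝ) (hp : 1 ≤ p) : Submodule ℂ (𝔻 → ℂ) where
  carrier := {f | MemHp p f}
  zero_mem' := by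
    have h0 : zeroExt (0 : 𝔻 → ℂ) = 0 := by
      funext z
      simpa using zeroExt_smul 0 0 z
    have hp0 : p ≠ 0 := by linarith
    refine ⟨by simp [IsAnalytic, h0], 0, ?_⟩
    rintro _ ⟨r, -, rfl⟩
    simp [integralMean, h0, Real.zero_rpow hp0, Real.circleAverage_const]
  add_mem' := by
    rintro f g ⟨hf, A, hA⟩ ⟨hg, B, hB⟩
    have hfg : IsAnalytic (f + g) := by
      have : zeroExt (f + g) = fun z => zeroExt f z + zeroExt g z := funext (zeroExt_add f g)
      rw [IsAnalytic, this]
      exact DifferentiableOn.add hf hg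
    refine ⟨hfg, 2 ^ (p - 1) * (A + B), ?_⟩
    rintro _ ⟨r, hr, rfl⟩
    have hp0 : 0 ≤ p := by linarith
    have h2 : (0 : ℝ) ≤ 2 ^ (p - 1) := by positivity
    have hIf := hf.circleIntegrable hp0 hr
    have hIg := hg.circleIntegrable hp0 hr
    calc integralMean p (f + g) r
        ≤ Real.circleAverage ((2 ^ (p - 1) : ℝ) •
            ((fun z => ‖zeroExt f z‖ ^ p) + fun z => ‖zeroExt g z‖ ^ p)) 0 r := by
          refine Real.circleAverage_mono (hfg.circleIntegrable hp0 hr)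
            ((hIf.add hIg).const_smul) ?_
          intro z _
          simp only [Pi.smul_apply, Pi.add_apply, smul_eq_mul]
          rw [zeroExt_add]
          refine (Real.rpow_le_rpow (norm_nonneg _) (norm_add_le _ _) hp0).trans ?_
          exact_mod_cast NNReal.rpow_add_le_mul_rpow_add_rpow ‖zeroExt f z‖₊ ‖zeroExt g z‖₊ hp
      _ = 2 ^ (p - 1) * (integralMean p f r + integralMean p g r) := by
          rw [Real.circleAverage_smul, Real.circleAverage_add hIf hIg]
          rfl
      _ ≤ 2 ^ (p - 1) * (A + B) := by
          refine mul_le_mul_of_nonneg_left (add_le_add ?_ ?_) h2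
          · exact hA ⟨r, hr, rfl⟩
          · exact hB ⟨r, hr, rfl⟩
  smul_mem' := by
    rintro c f ⟨hf, A, hA⟩
    have hcf : zeroExt (c • f) = fun z => c * zeroExt f z := funext (zeroExt_smul c f)
    refine ⟨?_, ‖c‖ ^ p * A, ?_⟩
    · rw [IsAnalytic, hcf]
      exact DifferentiableOn.const_mul hf c
    rintro _ ⟨r, hr, rfl⟩
    have : integralMean p (c • f) r = ‖c‖ ^ p * integralMean p f r := by
      rw [integralMean, integralMean, ← smul_eq_mul, ← Real.circleAverage_smul, hcf]
      congr 1
      funext z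
      simp [Real.mul_rpow]
    rw [this]
    exact mul_le_mul_of_nonneg_left (hA ⟨r, hr, rfl⟩) (by positivity)

/-- `M_F`, multiplication by `F`. -/
def mulOp (F : 𝔻 → ℂ) : Module.End ℂ (𝔻 → ℂ) := LinearMap.mulLeft ℂ F

/-- `C_φ`, composition `f ↦ f ∘ φ`. -/
def compOp (φ : DiscAut) : Module.End ℂ (𝔻 → ℂ) := LinearMap.funLeft ℂ ℂ φ

/-- `U_φ = M_{(conj lam * φ')^(1/p)} C_φ` with the principal branch of the power. -/
def U (p : ℝ) (φ : DiscAut) : Module.End ℂ (𝔻 → ℂ) :=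
  mulOp (fun z => (conj (φ.lam : ℂ) * deriv φ.formula (z : ℂ)) ^ ((1 / p : ℝ) : ℂ)) * compOp φ

/-- `S = M_ψ U_φ`. -/
def S (p : ℝ) (ψ φ : DiscAut) : Module.End ℂ (𝔻 → ℂ) :=
  mulOp (fun z => (ψ z : ℂ)) * U p φ

/-- The linear operator `T` maps `H^p` isometrically into `H^p`, and `T H^p` has codimension one
in `H^p`. -/
def IsCodimOneIsometry (p : ℝ) (hp : 1 ≤ p) (T : Module.End ℂ (𝔻 → ℂ)) : Prop :=
  (∀ f ∈ Hp p hp, T f ∈ Hp p hp ∧ hpNorm p (T f) = hpNorm p f) ∧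
    Module.finrank ℂ (Hp p hp ⧸ ((Hp p hp).map T).submoduleOf (Hp p hp)) = 1

/-- A codimension-one isometry `T` of `H^p` is Crownover if `⋂_{n ≥ 1} T^n H^p = 0`. -/
def IsCrownover (p : ℝ) (hp : 1 ≤ p) (T : Module.End ℂ (𝔻 → ℂ)) : Prop :=
  IsCodimOneIsometry p hp T ∧ (⨅ n : ℕ, ⨅ _ : 1 ≤ n, (Hp p hp).map (T ^ n)) = ⊥

/-- A Blaschke sequence in the disc: `∑ (1 - |z_k|) < ∞`. -/
def IsBlaschkeSeq (z : ℕ → 𝔻) : Prop :=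
  Summable fun k => 1 - ‖(z k : ℂ)‖

end HardyIsometry

end

/-!
The operator `U_φ` is an isometry: a change of variables on the circle and the monotonicity of
integral means make both `U_φ` and its inverse `U_{φ⁻¹}` contractions of `H^p`. Multiplication by
`ψ` is isometric because `|ψ| → 1` at the circle, and its range consists of the functions vanishing
at the zero of `ψ`. Moreover `S^n g = (∏_{k<n} ψ ∘ φ_k) · U_φ^n g`. If `∑ (1 - |a_k|) = ∞`, the
products tend to `0` pointwise, while for `f = S^n g_n` the functions `U_φ^n g_n` have the norm of
`f` and hence stay bounded at each point, so an `f` in all the ranges vanishes.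
If `∑ (1 - |a_k|) < ∞`, the Blaschke product with zeros `a_k` is in every range, since its first `n`
factors are those of `S^n` up to constants of modulus one.
-/

noncomputable section

open Complex Complex.UnitDisc Filter MeasureTheory Metric Topology
open Real (circleAverage)
open scoped ComplexConjugate

namespace HardyIsometry

namespace DiscAut

theorem re_denominator_pos (φ : DiscAut) {z : ℂ} (hz : ‖z‖ ≤ 1) :
    0 < (1 - conj (φ.a : ℂ) * z).re := by
  have h : ‖conj (φ.a : ℂ) * z‖ < 1 := by
    rw [norm_mul, RCLike.norm_conj]
    exact mul_lt_one_of_nonneg_of_lt_one_left (norm_nonneg _) φ.a.norm_lt_one hz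
  rw [sub_re, one_re, sub_pos]
  exact (re_le_norm _).trans_lt h

theorem denominator_ne_zero (φ : DiscAut) {z : ℂ} (hz : ‖z‖ ≤ 1) :
    1 - conj (φ.a : ℂ) * z ≠ 0 := fun h =>
  (φ.re_denominator_pos hz).ne' (by rw [h, zero_re])

theorem one_sub_norm_sq_pos (φ : DiscAut) : 0 < 1 - ‖(φ.a : ℂ)‖ ^ 2 :=
  sub_pos.2 φ.a.sq_norm_lt_one

theorem conj_lam_mul_lam (φ : DiscAut) : conj (φ.lam : ℂ) * φ.lam = 1 := by
  rw [conj_mul', Circle.norm_coe, ofReal_one, one_pow]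

@[simp]
theorem coe_apply (φ : DiscAut) (z : 𝔻) : ((φ z : 𝔻) : ℂ) = φ.formula z := rfl

theorem apply_eq_zero_iff (φ : DiscAut) (z : 𝔻) : φ z = 0 ↔ z = φ.a := by
  rw [← UnitDisc.coe_eq_zero, coe_apply, formula, div_eq_zero_iff,
    or_iff_left (φ.denominator_ne_zero z.norm_lt_one.le), mul_eq_zero,
    or_iff_right (Circle.coe_ne_zero _), sub_eq_zero, UnitDisc.coe_inj]

theorem one_sub_norm_formula_sq (φ : DiscAut) {z : ℂ} (hz : ‖z‖ ≤ 1) :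
    1 - ‖φ.formula z‖ ^ 2 =
      (1 - ‖(φ.a : ℂ)‖ ^ 2) * (1 - ‖z‖ ^ 2) / ‖1 - conj (φ.a : ℂ) * z‖ ^ 2 := by
  have h0 : ‖1 - conj (φ.a : ℂ) * z‖ ^ 2 ≠ 0 :=
    pow_ne_zero 2 (norm_ne_zero_iff.2 (φ.denominator_ne_zero hz))
  rw [formula, norm_div, norm_mul, Circle.norm_coe, one_mul, eq_div_iff h0, sub_mul, div_pow,
    div_mul_cancel₀ _ h0, one_mul]
  simp only [← normSq_eq_norm_sq, normSq_apply, sub_re, sub_im, mul_re, mul_im, one_re, one_im,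
    conj_re, conj_im]
  ring

theorem norm_formula_of_norm_eq_one (φ : DiscAut) {z : ℂ} (hz : ‖z‖ = 1) : ‖φ.formula z‖ = 1 := by
  have h := φ.one_sub_norm_formula_sq hz.le
  rw [hz, one_pow, sub_self, mul_zero, zero_div, sub_eq_zero] at h
  exact (pow_eq_one_iff_of_nonneg (norm_nonneg _) two_ne_zero).1 h.symm

theorem norm_formula_lt_one_of_norm_lt_one (φ : DiscAut) {z : ℂ} (hz : ‖z‖ < 1) :
    ‖φ.formula z‖ < 1 :=
  φ.norm_formula_lt_one (UnitDisc.mk z hz)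

theorem norm_formula_le_one (φ : DiscAut) {z : ℂ} (hz : ‖z‖ ≤ 1) : ‖φ.formula z‖ ≤ 1 :=
  hz.lt_or_eq.elim (fun h => (φ.norm_formula_lt_one_of_norm_lt_one h).le)
    fun h => (φ.norm_formula_of_norm_eq_one h).le

theorem one_sub_norm_a_mul_one_sub_norm_le (φ : DiscAut) {z : ℂ} (hz : ‖z‖ ≤ 1) :
    (1 - ‖(φ.a : ℂ)‖) * (1 - ‖z‖) ≤ 8 * (1 - ‖φ.formula z‖) := by
  have ha := φ.a.norm_lt_one
  have hden : ‖1 - conj (φ.a : ℂ) * z‖ ≤ 2 := by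
    have h := norm_sub_le (1 : ℂ) (conj (φ.a : ℂ) * z)
    rw [norm_one, norm_mul, RCLike.norm_conj] at h
    linarith [mul_le_one₀ ha.le (norm_nonneg z) hz]
  have hformula := φ.one_sub_norm_formula_sq hz
  have hpos : 0 < ‖1 - conj (φ.a : ℂ) * z‖ := norm_pos_iff.2 (φ.denominator_ne_zero hz)
  rw [eq_div_iff (by positivity)] at hformula
  have hle := φ.norm_formula_le_one hz
  calc (1 - ‖(φ.a : ℂ)‖) * (1 - ‖z‖)
      ≤ (1 - ‖(φ.a : ℂ)‖ ^ 2) * (1 - ‖z‖ ^ 2) := by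
        gcongr
        · exact φ.one_sub_norm_sq_pos.le
        · exact pow_le_of_le_one (norm_nonneg _) ha.le two_ne_zero
        · exact pow_le_of_le_one (norm_nonneg _) hz two_ne_zero
    _ = (1 - ‖φ.formula z‖ ^ 2) * ‖1 - conj (φ.a : ℂ) * z‖ ^ 2 := hformula.symm
    _ ≤ (2 * (1 - ‖φ.formula z‖)) * 2 ^ 2 := by
        gcongr
        nlinarith only [sq_nonneg (1 - ‖φ.formula z‖)]
    _ = 8 * (1 - ‖φ.formula z‖) := by ring

theorem hasDerivAt_formula (φ : DiscAut) {z : ℂ} (hz : ‖z‖ ≤ 1) :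
    HasDerivAt φ.formula
      ((φ.lam : ℂ) * ((1 - ‖(φ.a : ℂ)‖ ^ 2 : ℝ) / (1 - conj (φ.a : ℂ) * z) ^ 2)) z := by
  have hnum : HasDerivAt (fun z : ℂ => (φ.lam : ℂ) * (z - φ.a)) ((φ.lam : ℂ) * 1) z :=
    ((hasDerivAt_id z).sub_const _).const_mul _
  have hden : HasDerivAt (fun z : ℂ => 1 - conj (φ.a : ℂ) * z) (-(conj (φ.a : ℂ) * 1)) z :=
    ((hasDerivAt_id z).const_mul _).const_sub _
  refine (hnum.div hden (φ.denominator_ne_zero hz)).congr_deriv ?_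
  rw [← mul_div_assoc]
  congr 1
  push_cast
  rw [← conj_mul' (φ.a : ℂ)]
  ring

theorem analyticAt_formula (φ : DiscAut) {z : ℂ} (hz : ‖z‖ ≤ 1) : AnalyticAt ℂ φ.formula z := by
  unfold formula
  exact AnalyticAt.div (by fun_prop) (by fun_prop) (φ.denominator_ne_zero hz)

theorem conj_lam_mul_deriv_formula (φ : DiscAut) {z : ℂ} (hz : ‖z‖ ≤ 1) :
    conj (φ.lam : ℂ) * deriv φ.formula z =
      (1 - ‖(φ.a : ℂ)‖ ^ 2 : ℝ) / (1 - conj (φ.a : ℂ) * z) ^ 2 := by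
  rw [(φ.hasDerivAt_formula hz).deriv, ← mul_assoc, conj_lam_mul_lam, one_mul]

theorem norm_deriv_formula (φ : DiscAut) {z : ℂ} (hz : ‖z‖ ≤ 1) :
    ‖deriv φ.formula z‖ = (1 - ‖(φ.a : ℂ)‖ ^ 2) / ‖1 - conj (φ.a : ℂ) * z‖ ^ 2 := by
  rw [(φ.hasDerivAt_formula hz).deriv, norm_mul, Circle.norm_coe, one_mul, norm_div, norm_pow,
    norm_real, Real.norm_of_nonneg φ.one_sub_norm_sq_pos.le]

/-! ### The group of disc automorphisms -/

/-- The inverse automorphism. -/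
def inv (φ : DiscAut) : DiscAut where
  lam := φ.lam⁻¹
  a := -(φ.lam • φ.a)

theorem coe_inv_lam (φ : DiscAut) : (φ.inv.lam : ℂ) = conj (φ.lam : ℂ) :=
  Circle.coe_inv_eq_conj φ.lam

theorem coe_inv_a (φ : DiscAut) : (φ.inv.a : ℂ) = -((φ.lam : ℂ) * φ.a) := rfl

theorem norm_coe_inv_a (φ : DiscAut) : ‖(φ.inv.a : ℂ)‖ = ‖(φ.a : ℂ)‖ := by
  rw [coe_inv_a, norm_neg, norm_mul, Circle.norm_coe, one_mul]

theorem formula_inv_formula (φ : DiscAut) {z : ℂ} (hz : ‖z‖ ≤ 1) :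
    φ.inv.formula (φ.formula z) = z := by
  have hden := φ.inv.denominator_ne_zero (φ.norm_formula_le_one hz)
  have hq := div_mul_cancel₀ (z - φ.a) (φ.denominator_ne_zero hz)
  rw [formula, div_eq_iff hden, coe_inv_lam, coe_inv_a, formula, mul_div_assoc]
  generalize (z - (φ.a : ℂ)) / (1 - conj (φ.a : ℂ) * z) = q at hq
  simp only [map_neg, map_mul]
  linear_combination (q + φ.a - z * conj (φ.a : ℂ) * q) * φ.conj_lam_mul_lam + hq

theorem inv_apply_apply (φ : DiscAut) (z : 𝔻) : φ.inv (φ z) = z :=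
  UnitDisc.coe_injective (φ.formula_inv_formula z.norm_lt_one.le)

theorem inv_inv (φ : DiscAut) : φ.inv.inv = φ := by
  have ha : φ.inv.inv.a = φ.a := by
    rw [← UnitDisc.coe_inj, coe_inv_a, coe_inv_a, coe_inv_lam]
    linear_combination (φ.a : ℂ) * φ.conj_lam_mul_lam
  have hlam : φ.inv.inv.lam = φ.lam := _root_.inv_inv φ.lam
  calc φ.inv.inv = ⟨φ.inv.inv.lam, φ.inv.inv.a⟩ := rfl
    _ = φ := by rw [hlam, ha]

theorem one_add_conj_mul_ne_zero (φ ψ : DiscAut) :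
    1 + conj (φ.a : ℂ) * (ψ.lam * ψ.a) ≠ 0 := by
  have h := φ.denominator_ne_zero ψ.inv.a.norm_lt_one.le
  rwa [coe_inv_a, mul_neg, sub_neg_eq_add] at h

/-- The composition `φ ∘ ψ` of two automorphisms. Its zero is `ψ⁻¹ (φ.a)`, and the quotient
`conj w / w` in its leading factor normalizes the denominator of `φ (ψ z)` to be `1` at `z = 0`. -/
def comp (φ ψ : DiscAut) : DiscAut where
  lam := φ.lam * ψ.lam * Circle.ofConjDivSelf _ (φ.one_add_conj_mul_ne_zero ψ)
  a := ψ.inv φ.a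

theorem coe_comp_a_mul (φ ψ : DiscAut) :
    ((φ.comp ψ).a : ℂ) * conj (1 + conj (φ.a : ℂ) * (ψ.lam * ψ.a)) =
      conj (ψ.lam : ℂ) * φ.a + ψ.a := by
  have hD := ψ.inv.denominator_ne_zero φ.a.norm_lt_one.le
  have hc : ((φ.comp ψ).a : ℂ) =
      ψ.inv.lam * (φ.a - ψ.inv.a) / (1 - conj (ψ.inv.a : ℂ) * φ.a) := rfl
  rw [eq_div_iff hD] at hc
  simp only [coe_inv_lam, coe_inv_a, map_neg, map_mul, map_add, map_one, Complex.conj_conj] at hc ⊢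
  linear_combination hc + (ψ.a : ℂ) * ψ.conj_lam_mul_lam

theorem formula_comp (φ ψ : DiscAut) {z : ℂ} (hz : ‖z‖ ≤ 1) :
    (φ.comp ψ).formula z = φ.formula (ψ.formula z) := by
  have hq : ψ.formula z * (1 - conj (ψ.a : ℂ) * z) = ψ.lam * (z - ψ.a) :=
    div_mul_cancel₀ _ (ψ.denominator_ne_zero hz)
  have hw := φ.one_add_conj_mul_ne_zero ψ
  have hc := φ.coe_comp_a_mul ψ
  have hlam : ((φ.comp ψ).lam : ℂ) * (1 + conj (φ.a : ℂ) * (ψ.lam * ψ.a)) =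
      φ.lam * ψ.lam * conj (1 + conj (φ.a : ℂ) * (ψ.lam * ψ.a)) := by
    rw [comp, Circle.coe_mul, Circle.coe_mul, Circle.ofConjDivSelf_coe, mul_assoc,
      div_mul_cancel₀ _ hw]
  have num : ((φ.comp ψ).lam : ℂ) * (z - (φ.comp ψ).a) *
      (1 + conj (φ.a : ℂ) * (ψ.lam * ψ.a)) =
      φ.lam * (ψ.formula z - φ.a) * (1 - conj (ψ.a : ℂ) * z) := by
    simp only [map_add, map_mul, map_one, Complex.conj_conj] at hc hlam
    linear_combination (z - (φ.comp ψ).a) * hlam - φ.lam * ψ.lam * hc - φ.lam * hq +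
      φ.lam * (z * φ.a * conj (ψ.a : ℂ) - φ.a) * ψ.conj_lam_mul_lam
  have den : (1 - conj ((φ.comp ψ).a : ℂ) * z) * (1 + conj (φ.a : ℂ) * (ψ.lam * ψ.a)) =
      (1 - conj (φ.a : ℂ) * ψ.formula z) * (1 - conj (ψ.a : ℂ) * z) := by
    have hc' := congrArg conj hc
    simp only [map_add, map_mul, map_one, Complex.conj_conj] at hc'
    linear_combination -z * hc' + conj (φ.a : ℂ) * hq
  rw [formula, formula.eq_def φ, ← mul_div_mul_right _ _ hw, num, den,
    mul_div_mul_right _ _ (ψ.denominator_ne_zero hz)]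

theorem comp_apply (φ ψ : DiscAut) (z : 𝔻) : φ.comp ψ z = φ (ψ z) :=
  UnitDisc.coe_injective (φ.formula_comp ψ z.norm_lt_one.le)

/-- The automorphism `ψ ∘ φ ∘ ⋯ ∘ φ` with `k` factors `φ`. -/
def compIterate (ψ φ : DiscAut) : ℕ → DiscAut
  | 0 => ψ
  | k + 1 => (compIterate ψ φ k).comp φ

theorem compIterate_apply (ψ φ : DiscAut) (k : ℕ) (z : 𝔻) :
    ψ.compIterate φ k z = ψ (φ^[k] z) := by
  induction k generalizing z with
  | zero => rfl
  | succ k ih => rw [compIterate, comp_apply, ih, Function.iterate_succ_apply]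

end DiscAut

/-! ### The weighted composition operators -/

theorem ofReal_mul_sq_mem_slitPlane {N : ℝ} (hN : 0 < N) {z : ℂ} (hz : 0 < z.re) :
    N * z ^ 2 ∈ slitPlane := by
  rw [mem_slitPlane_iff, re_ofReal_mul, im_ofReal_mul, pow_two, mul_re, mul_im]
  by_cases him : z.im = 0
  · left
    rw [him, mul_zero, sub_zero]
    positivity
  · right
    rw [mul_comm z.im, ← two_mul]
    exact mul_ne_zero hN.ne' (mul_ne_zero two_ne_zero (mul_ne_zero hz.ne' him))

namespace DiscAut

theorem conj_lam_mul_deriv_formula_mem_slitPlane (φ : DiscAut) {z : ℂ} (hz : ‖z‖ ≤ 1) :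
    conj (φ.lam : ℂ) * deriv φ.formula z ∈ slitPlane := by
  rw [φ.conj_lam_mul_deriv_formula hz, div_eq_mul_inv, ← inv_pow]
  refine ofReal_mul_sq_mem_slitPlane φ.one_sub_norm_sq_pos ?_
  rw [inv_re]
  exact div_pos (φ.re_denominator_pos hz) (normSq_pos.2 (φ.denominator_ne_zero hz))

/-- The weight `(conj lam * φ')^(1/p)` of `U_φ`, as a function on `ℂ`. -/
def weight (p : ℝ) (φ : DiscAut) (z : ℂ) : ℂ :=
  (conj (φ.lam : ℂ) * deriv φ.formula z) ^ ((1 / p : ℝ) : ℂ)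

theorem norm_weight_rpow {p : ℝ} (hp : p ≠ 0) (φ : DiscAut) (z : ℂ) :
    ‖φ.weight p z‖ ^ p = ‖deriv φ.formula z‖ := by
  rw [weight, norm_cpow_real, ← Real.rpow_mul (norm_nonneg _), one_div_mul_cancel hp,
    Real.rpow_one, norm_mul, RCLike.norm_conj, Circle.norm_coe, one_mul]

theorem differentiableAt_weight (p : ℝ) (φ : DiscAut) {z : ℂ} (hz : ‖z‖ ≤ 1) :
    DifferentiableAt ℂ (φ.weight p) z :=
  ((φ.analyticAt_formula hz).deriv.differentiableAt.const_mul _).cpow_const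
    (φ.conj_lam_mul_deriv_formula_mem_slitPlane hz)

theorem conj_lam_mul_deriv_formula_inv (φ : DiscAut) {z : ℂ} (hz : ‖z‖ ≤ 1) :
    conj (φ.inv.lam : ℂ) * deriv φ.inv.formula (φ.formula z) =
      (conj (φ.lam : ℂ) * deriv φ.formula z)⁻¹ := by
  have hd := φ.denominator_ne_zero hz
  have hN : ((1 - ‖(φ.a : ℂ)‖ ^ 2 : ℝ) : ℂ) ≠ 0 := ofReal_ne_zero.2 φ.one_sub_norm_sq_pos.ne'
  have hden : (1 - conj (φ.inv.a : ℂ) * φ.formula z) * (1 - conj (φ.a : ℂ) * z) =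
      (1 - ‖(φ.a : ℂ)‖ ^ 2 : ℝ) := by
    have hq := div_mul_cancel₀ ((φ.lam : ℂ) * (z - φ.a)) hd
    rw [← formula] at hq
    push_cast
    rw [coe_inv_a, ← conj_mul' (φ.a : ℂ), map_neg, map_mul]
    linear_combination conj (φ.lam : ℂ) * conj (φ.a : ℂ) * hq +
      conj (φ.a : ℂ) * (z - φ.a) * φ.conj_lam_mul_lam
  rw [conj_lam_mul_deriv_formula _ (φ.norm_formula_le_one hz), φ.conj_lam_mul_deriv_formula hz,
    norm_coe_inv_a, inv_div, eq_div_of_mul_eq hd hden, div_pow, div_div_eq_mul_div,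
    pow_two (ofReal _), mul_div_mul_left _ _ hN]

theorem weight_inv_mul_weight (p : ℝ) (φ : DiscAut) {z : ℂ} (hz : ‖z‖ ≤ 1) :
    φ.inv.weight p (φ.formula z) * φ.weight p z = 1 := by
  have hslit := φ.conj_lam_mul_deriv_formula_mem_slitPlane hz
  rw [weight, weight, φ.conj_lam_mul_deriv_formula_inv hz,
    inv_cpow _ _ (mem_slitPlane_iff_arg.1 hslit).1]
  exact inv_mul_cancel₀ fun h => slitPlane_ne_zero hslit ((cpow_eq_zero_iff _ _).1 h).1

end DiscAut

theorem U_apply (p : ℝ) (φ : DiscAut) (f : 𝔻 → ℂ) (z : 𝔻) :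
    U p φ f z = φ.weight p z * f (φ z) := rfl

theorem U_mul_U_inv (p : ℝ) (φ : DiscAut) : U p φ * U p φ.inv = 1 := by
  ext f z
  rw [Module.End.mul_apply, U_apply, U_apply, ← mul_assoc, mul_comm (φ.weight p z),
    DiscAut.coe_apply, φ.weight_inv_mul_weight p z.norm_lt_one.le, one_mul, φ.inv_apply_apply,
    Module.End.one_apply]

theorem U_inv_mul_U (p : ℝ) (φ : DiscAut) : U p φ.inv * U p φ = 1 := by
  simpa only [φ.inv_inv] using U_mul_U_inv p φ.inv

theorem S_apply (p : ℝ) (ψ φ : DiscAut) (f : 𝔻 → ℂ) (z : 𝔻) :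
    S p ψ φ f z = ψ z * U p φ f z := rfl

theorem S_pow_apply (p : ℝ) (ψ φ : DiscAut) (n : ℕ) (f : 𝔻 → ℂ) (z : 𝔻) :
    (S p ψ φ ^ n) f z = (∏ k ∈ Finset.range n, ψ.compIterate φ k z : ℂ) * (U p φ ^ n) f z := by
  induction n generalizing z with
  | zero => simp only [pow_zero, Finset.prod_range_zero, one_mul]
  | succ n ih =>
    rw [pow_succ', Module.End.mul_apply, S_apply, U_apply, ih, pow_succ', Module.End.mul_apply,
      U_apply, Finset.prod_range_succ']
    simp only [DiscAut.compIterate, DiscAut.comp_apply]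
    ring

/-! ### Circle averages and weighted composition -/

theorem continuousOn_norm_rpow {X E : Type*} [TopologicalSpace X] [SeminormedAddCommGroup E]
    {F : X → E} {s : Set X} (hF : ContinuousOn F s) {p : ℝ} (hp : 0 ≤ p) :
    ContinuousOn (fun z => ‖F z‖ ^ p) s :=
  hF.norm.rpow_const fun _ _ => Or.inr hp

section CircleAverage

variable {E : Type*} [NormedAddCommGroup E] [NormedSpace ℝ E]

theorem circleAverage_mul_left_of_norm_eq_one (h : ℂ → E) {c : ℂ} (hc : ‖c‖ = 1) :
    circleAverage (fun z => h (c * z)) 0 1 = circleAverage h 0 1 := by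
  rw [Real.circleAverage_eq_integral_add (f := h) (arg c), circleAverage]
  have hc' : cexp (arg c * I) = c := by
    simpa only [hc, ofReal_one, one_mul] using norm_mul_exp_arg_mul_I c
  congr 2 with θ
  simp only [circleMap_zero, ofReal_one, one_mul, ofReal_add, add_mul, Complex.exp_add, hc']
  rw [mul_comm]

theorem circleAverage_eq_circleAverage_dilation (h : ℂ → E) (R : ℝ) :
    circleAverage h 0 R = circleAverage (fun z => h (R * z)) 0 1 := by
  rw [Real.circleAverage_eq_circleAverage_zero_one]
  simp only [add_zero]

theorem continuousOn_circleAverage {X : Type*} [TopologicalSpace X] {s : Set X} {G : X → ℂ → E}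
    {c : ℂ} {R : ℝ} (hG : ContinuousOn (Function.uncurry G) (s ×ˢ sphere c |R|)) :
    ContinuousOn (fun x => circleAverage (G x) c R) s := by
  rw [continuousOn_iff_continuous_domRestrict]
  refine (intervalIntegral.continuous_parametric_intervalIntegral_of_continuous'
    (f := fun (x : s) θ => G x (circleMap c R θ)) ?_ 0 (2 * Real.pi)).const_smul _
  exact hG.comp_continuous (f := fun x : s × ℝ => ((x.1 : X), circleMap c R x.2)) (by fun_prop)
    fun x => ⟨x.1.2, circleMap_mem_sphere' c R x.2⟩

theorem circleAverage_swap {G : ℂ → ℂ → E} {c d : ℂ} {R R' : ℝ}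
    (hG : ContinuousOn (Function.uncurry G) (sphere c |R| ×ˢ sphere d |R'|)) :
    circleAverage (fun z => circleAverage (G z) d R') c R =
      circleAverage (fun w => circleAverage (fun z => G z w) c R) d R' := by
  have hcont : Continuous fun x : ℝ × ℝ => G (circleMap c R x.1) (circleMap d R' x.2) :=
    hG.comp_continuous (f := fun x : ℝ × ℝ => (circleMap c R x.1, circleMap d R' x.2))
      (by fun_prop) fun x => ⟨circleMap_mem_sphere' c R x.1, circleMap_mem_sphere' d R' x.2⟩
  simp only [circleAverage, intervalIntegral.integral_smul]
  rw [smul_comm, MeasureTheory.intervalIntegral_intervalIntegral_swap]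
  exact (hcont.continuousOn.integrableOn_compact (isCompact_uIcc.prod isCompact_uIcc)).mono_set
    (Set.prod_mono Set.uIoc_subset_uIcc Set.uIoc_subset_uIcc)

theorem norm_circleAverage_le (F : ℂ → E) (c : ℂ) (R : ℝ) :
    ‖circleAverage F c R‖ ≤ circleAverage (fun z => ‖F z‖) c R := by
  rw [circleAverage, circleAverage, norm_smul, smul_eq_mul,
    Real.norm_of_nonneg (inv_nonneg.2 Real.two_pi_pos.le)]
  gcongr
  exact intervalIntegral.norm_integral_le_integral_norm Real.two_pi_pos.le

theorem circleAverage_rpow_le {p : ℝ} (hp : 1 ≤ p) {f : ℂ → ℝ} {c : ℂ} {R : ℝ}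
    (hf : ContinuousOn f (sphere c |R|)) (hf0 : ∀ z, 0 ≤ f z) :
    circleAverage f c R ^ p ≤ circleAverage (fun z => f z ^ p) c R := by
  have hp0 : 0 ≤ p := zero_le_one.trans hp
  have hcont : Continuous fun θ => f (circleMap c R θ) :=
    hf.comp_continuous (continuous_circleMap c R) (circleMap_mem_sphere' c R)
  have hint : ∀ g : ℝ → ℝ, Continuous g →
      Integrable g (volume.restrict (Set.uIoc 0 (2 * Real.pi))) := fun g hg =>
    intervalIntegrable_iff.1 (hg.intervalIntegrable _ _)
  have : NeZero (volume.restrict (Set.uIoc 0 (2 * Real.pi))) := by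
    refine ⟨Measure.restrict_eq_zero.not.2 ?_⟩
    rw [Set.uIoc_of_le Real.two_pi_pos.le, Real.volume_Ioc, sub_zero, ENNReal.ofReal_eq_zero,
      not_le]
    exact Real.two_pi_pos
  have : IsFiniteMeasure (volume.restrict (Set.uIoc 0 (2 * Real.pi))) := by
    rw [Set.uIoc_of_le Real.two_pi_pos.le]
    infer_instance
  rw [Real.circleAverage_eq_intervalAverage, Real.circleAverage_eq_intervalAverage]
  exact (convexOn_rpow hp).map_average_le (continuousOn_id.rpow_const fun _ _ => Or.inr hp0)
    isClosed_Ici (ae_of_all _ fun θ => hf0 _) (hint _ hcont)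
    (hint _ (hcont.rpow_const fun _ => Or.inr hp0))

theorem norm_circleAverage_rpow_le {p : ℝ} (hp : 1 ≤ p) {F : ℂ → E} {c : ℂ} {R : ℝ}
    (hF : ContinuousOn F (sphere c |R|)) :
    ‖circleAverage F c R‖ ^ p ≤ circleAverage (fun z => ‖F z‖ ^ p) c R :=
  (Real.rpow_le_rpow (norm_nonneg _) (norm_circleAverage_le F c R) (zero_le_one.trans hp)).trans
    (circleAverage_rpow_le hp hF.norm fun _ => norm_nonneg _)

end CircleAverage

theorem norm_rpow_le_circleAverage {p : ℝ} (hp : 1 ≤ p) {F : ℂ → ℂ} {c : ℂ} {R : ℝ}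
    (hF : DiffContOnCl ℂ F (ball c |R|)) :
    ‖F c‖ ^ p ≤ circleAverage (fun z => ‖F z‖ ^ p) c R := by
  rcases eq_or_ne R 0 with rfl | hR
  · rw [Real.circleAverage_zero]
  · have hmean : circleAverage F c R = F c := DiffContOnCl.circleAverage hF
    rw [← hmean]
    exact norm_circleAverage_rpow_le hp (hF.continuousOn.mono
      (sphere_subset_closedBall.trans (closure_ball c (abs_pos.2 hR).ne').ge))

theorem diffContOnCl_dilation {F : ℂ → ℂ} (hF : DifferentiableOn ℂ F (ball 0 1)) {R : ℝ}
    (hR : R ∈ Set.Ioo (0 : ℝ) 1) : DiffContOnCl ℂ (fun z => F (R * z)) (ball 0 1) := by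
  refine DifferentiableOn.diffContOnCl (hF.comp (by fun_prop) fun z hz => ?_)
  rw [closure_ball _ one_ne_zero, mem_closedBall_zero_iff] at hz
  rw [mem_ball_zero_iff, norm_mul, norm_real, Real.norm_of_nonneg hR.1.le]
  exact mul_lt_one_of_nonneg_of_lt_one_left hR.1.le hR.2 hz

theorem diffContOnCl_ball_of_differentiableAt {F : ℂ → ℂ}
    (hF : ∀ z, ‖z‖ ≤ 1 → DifferentiableAt ℂ F z) : DiffContOnCl ℂ F (ball 0 1) := by
  refine DifferentiableOn.diffContOnCl fun z hz => (hF z ?_).differentiableWithinAt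
  rwa [closure_ball _ one_ne_zero, mem_closedBall_zero_iff] at hz

namespace DiscAut

theorem diffContOnCl_formula (φ : DiscAut) : DiffContOnCl ℂ φ.formula (ball 0 1) :=
  diffContOnCl_ball_of_differentiableAt fun _ hz => (φ.analyticAt_formula hz).differentiableAt

theorem mapsTo_formula_ball (φ : DiscAut) : Set.MapsTo φ.formula (ball 0 1) (ball 0 1) :=
  fun _ hz => mem_ball_zero_iff.2 (φ.norm_formula_lt_one_of_norm_lt_one (mem_ball_zero_iff.1 hz))

theorem mapsTo_formula_sphere (φ : DiscAut) : Set.MapsTo φ.formula (sphere 0 1) (sphere 0 1) :=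
  fun _ hz => mem_sphere_zero_iff_norm.2
    (φ.norm_formula_of_norm_eq_one (mem_sphere_zero_iff_norm.1 hz))

end DiscAut

/-- The automorphism `z ↦ (z + w) / (1 + conj w * z)`, which moves `0` to `w`. -/
def DiscAut.translation (w : 𝔻) : DiscAut := ⟨1, -w⟩

theorem DiscAut.formula_translation_zero (w : 𝔻) : (translation w).formula 0 = w := by
  simp [translation, formula]

section Monotonicity

variable {p : ℝ} {F : ℂ → ℂ}

theorem DiscAut.norm_rpow_mul_formula_zero_le (hp : 1 ≤ p) (hF : DiffContOnCl ℂ F (ball 0 1))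
    (u : DiscAut) {z : ℂ} (hz : ‖z‖ = 1) :
    ‖F (z * u.formula 0)‖ ^ p ≤ circleAverage (fun w => ‖F (z * u.formula w)‖ ^ p) 0 1 := by
  have hFz : DiffContOnCl ℂ (fun w => F (z * w)) (ball 0 1) :=
    hF.comp (Differentiable.diffContOnCl (by fun_prop)) fun w hw => by
      rwa [mem_ball_zero_iff, norm_mul, hz, one_mul, ← mem_ball_zero_iff]
  refine norm_rpow_le_circleAverage hp (c := 0) (R := 1) (F := fun w => F (z * u.formula w)) ?_
  rw [abs_one]
  exact hFz.comp u.diffContOnCl_formula u.mapsTo_formula_ball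

theorem DiscAut.continuousOn_norm_rpow_mul_formula (hp : 0 ≤ p) (hF : ContinuousOn F (sphere 0 1))
    (u : DiscAut) :
    ContinuousOn (Function.uncurry fun z w => ‖F (z * u.formula w)‖ ^ p)
      (sphere 0 1 ×ˢ sphere 0 1) := by
  have hu : ContinuousOn u.formula (sphere 0 1) := fun w hw =>
    (u.analyticAt_formula (mem_sphere_zero_iff_norm.1 hw).le).continuousAt.continuousWithinAt
  refine continuousOn_norm_rpow (hF.comp (f := fun x : ℂ × ℂ => x.1 * u.formula x.2)
    (continuousOn_fst.mul (hu.comp continuousOn_snd fun x hx => hx.2)) fun x hx => ?_) hp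
  rw [mem_sphere_zero_iff_norm, norm_mul, mem_sphere_zero_iff_norm.1 hx.1,
    mem_sphere_zero_iff_norm.1 (u.mapsTo_formula_sphere hx.2), one_mul]

-- An automorphism `u` with `u 0 = w` turns `F (w * z)` into a central value. Averaging the sub-mean
-- value inequality over the rotations `z`, rotation invariance removes `u` again.
theorem circleAverage_norm_rpow_dilation_le (hp : 1 ≤ p) (hF : DiffContOnCl ℂ F (ball 0 1))
    (w : 𝔻) :
    circleAverage (fun z => ‖F (w * z)‖ ^ p) 0 1 ≤ circleAverage (fun z => ‖F z‖ ^ p) 0 1 := by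
  have hp0 : 0 ≤ p := zero_le_one.trans hp
  let u := DiscAut.translation w
  have hu0 : u.formula 0 = w := DiscAut.formula_translation_zero w
  have hcont : ContinuousOn F (closedBall 0 1) := by
    simpa only [closure_ball _ (one_ne_zero (α := ℝ))] using hF.continuousOn
  have hG : ContinuousOn (Function.uncurry fun z η => ‖F (z * u.formula η)‖ ^ p)
      (sphere 0 |1| ×ˢ sphere 0 |1|) := by
    rw [abs_one]
    exact u.continuousOn_norm_rpow_mul_formula hp0 (hcont.mono sphere_subset_closedBall)
  calc circleAverage (fun z => ‖F (w * z)‖ ^ p) 0 1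
      ≤ circleAverage (fun z => circleAverage (fun η => ‖F (z * u.formula η)‖ ^ p) 0 1) 0 1 := by
        refine Real.circleAverage_mono (ContinuousOn.circleIntegrable' ?_)
          (continuousOn_circleAverage hG).circleIntegrable' fun z hz => ?_
        · refine continuousOn_norm_rpow (hcont.comp (by fun_prop) fun z hz => ?_) hp0
          rw [abs_one, mem_sphere_zero_iff_norm] at hz
          rw [mem_closedBall_zero_iff, norm_mul, hz, mul_one]
          exact w.norm_lt_one.le
        · rw [abs_one, mem_sphere_zero_iff_norm] at hz
          simpa only [hu0, mul_comm z] using u.norm_rpow_mul_formula_zero_le hp hF hz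
    _ = circleAverage (fun η => circleAverage (fun z => ‖F (z * u.formula η)‖ ^ p) 0 1) 0 1 :=
        circleAverage_swap hG
    _ = circleAverage (fun _ => circleAverage (fun z => ‖F z‖ ^ p) 0 1) 0 1 := by
        refine Real.circleAverage_congr_sphere fun η hη => ?_
        rw [abs_one] at hη
        simpa only [mul_comm] using circleAverage_mul_left_of_norm_eq_one (fun z => ‖F z‖ ^ p)
          (mem_sphere_zero_iff_norm.1 (u.mapsTo_formula_sphere hη))
    _ = circleAverage (fun z => ‖F z‖ ^ p) 0 1 := Real.circleAverage_const _ 0 1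

theorem circleAverage_norm_rpow_le_of_lt_one (hp : 1 ≤ p) (hF : DiffContOnCl ℂ F (ball 0 1))
    {r : ℝ} (hr0 : 0 ≤ r) (hr : r < 1) :
    circleAverage (fun z => ‖F z‖ ^ p) 0 r ≤ circleAverage (fun z => ‖F z‖ ^ p) 0 1 := by
  rw [circleAverage_eq_circleAverage_dilation]
  exact circleAverage_norm_rpow_dilation_le hp hF
    (UnitDisc.mk r (by rwa [norm_real, Real.norm_of_nonneg hr0]))

theorem circleAverage_norm_rpow_mono (hp : 1 ≤ p) (hF : DifferentiableOn ℂ F (ball 0 1))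
    {r s : ℝ} (hr : 0 ≤ r) (hrs : r ≤ s) (hs : s < 1) :
    circleAverage (fun z => ‖F z‖ ^ p) 0 r ≤ circleAverage (fun z => ‖F z‖ ^ p) 0 s := by
  rcases hrs.eq_or_lt with rfl | hlt
  · exact le_rfl
  have hs0 : 0 < s := hr.trans_lt hlt
  have h := circleAverage_norm_rpow_le_of_lt_one hp (diffContOnCl_dilation hF ⟨hs0, hs⟩)
    (div_nonneg hr hs0.le) ((div_lt_one hs0).2 hlt)
  rw [← circleAverage_eq_circleAverage_dilation (fun z => ‖F z‖ ^ p) s,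
    circleAverage_eq_circleAverage_dilation _ (r / s)] at h
  simpa only [← mul_assoc, ← ofReal_mul, mul_div_cancel₀ r hs0.ne',
    ← circleAverage_eq_circleAverage_dilation (fun z => ‖F z‖ ^ p) r] using h

end Monotonicity

/-! ### Change of variables on the circle -/

theorem one_add_two_mul_re_div_one_sub {x : ℂ} (hx : 1 - x ≠ 0) :
    1 + 2 * (x / (1 - x)).re = (1 - ‖x‖ ^ 2) / ‖1 - x‖ ^ 2 := by
  rw [← normSq_eq_norm_sq, ← normSq_eq_norm_sq, eq_div_iff (normSq_eq_zero.not.2 hx), div_re,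
    ← add_div, add_mul, mul_assoc, div_mul_cancel₀ _ (normSq_eq_zero.not.2 hx)]
  simp only [normSq_apply, sub_re, sub_im, one_re, one_im]
  ring

theorem exp_neg_two_mul_im_log_mul_I {z : ℂ} (hz : z ≠ 0) :
    cexp ((-(2 * (Complex.log z).im) : ℝ) * I) = conj z / z := by
  have h : ((-(2 * (Complex.log z).im) : ℝ) : ℂ) * I = conj (Complex.log z) - Complex.log z := by
    rw [← neg_sub, sub_conj, ofReal_neg, ofReal_mul]
    push_cast
    ring
  rw [h, Complex.exp_sub, exp_conj, Complex.exp_log hz]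

namespace DiscAut

/-- A lift to the real line of the action of the automorphism on the unit circle, parametrized by
`θ ↦ exp (θ * I)`. -/
def angle (φ : DiscAut) (θ : ℝ) : ℝ :=
  θ + arg (φ.lam : ℂ) - 2 * (Complex.log (1 - conj (φ.a : ℂ) * circleMap 0 1 θ)).im

theorem circleMap_angle (φ : DiscAut) (θ : ℝ) :
    circleMap 0 1 (φ.angle θ) = φ.formula (circleMap 0 1 θ) := by
  have hd : 1 - conj (φ.a : ℂ) * circleMap 0 1 θ ≠ 0 := φ.denominator_ne_zero (by simp)
  have hlam : cexp (arg (φ.lam : ℂ) * I) = φ.lam := by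
    simpa only [Circle.norm_coe, ofReal_one, one_mul] using norm_mul_exp_arg_mul_I (φ.lam : ℂ)
  have hconj : circleMap 0 1 θ * conj (1 - conj (φ.a : ℂ) * circleMap 0 1 θ) =
      circleMap 0 1 θ - φ.a := by
    have hunit : circleMap 0 1 θ * conj (circleMap 0 1 θ) = 1 := by
      simp [Complex.mul_conj']
    simp only [map_sub, map_mul, map_one, Complex.conj_conj]
    linear_combination -(φ.a : ℂ) * hunit
  calc circleMap 0 1 (φ.angle θ)
      = circleMap 0 1 θ * cexp (arg (φ.lam : ℂ) * I) *
          cexp ((-(2 * (Complex.log (1 - conj (φ.a : ℂ) * circleMap 0 1 θ)).im) : ℝ) * I) := by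
        rw [angle]
        generalize (Complex.log _).im = L
        simp only [circleMap_zero, ofReal_one, one_mul, ← Complex.exp_add]
        push_cast
        ring_nf
    _ = φ.lam * (circleMap 0 1 θ * conj (1 - conj (φ.a : ℂ) * circleMap 0 1 θ)) /
          (1 - conj (φ.a : ℂ) * circleMap 0 1 θ) := by
        rw [hlam, exp_neg_two_mul_im_log_mul_I hd]
        ring
    _ = φ.formula (circleMap 0 1 θ) := by rw [hconj, formula]

theorem hasDerivAt_angle (φ : DiscAut) (θ : ℝ) :
    HasDerivAt φ.angle ‖deriv φ.formula (circleMap 0 1 θ)‖ θ := by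
  have hz : ‖circleMap 0 1 θ‖ ≤ 1 := by simp
  have hd := φ.denominator_ne_zero hz
  have hlog : HasDerivAt (fun t : ℝ => Complex.log (1 - conj (φ.a : ℂ) * circleMap 0 1 t))
      (-(conj (φ.a : ℂ) * (circleMap 0 1 θ * I)) / (1 - conj (φ.a : ℂ) * circleMap 0 1 θ)) θ :=
    (((hasDerivAt_circleMap 0 1 θ).const_mul _).const_sub 1).clog_real
      (Or.inl (φ.re_denominator_pos hz))
  have him := (imCLM.hasFDerivAt.comp_hasDerivAt θ hlog).const_mul 2
  refine (((hasDerivAt_id θ).add_const (arg (φ.lam : ℂ))).sub him).congr_deriv ?_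
  have hx : ‖conj (φ.a : ℂ) * circleMap 0 1 θ‖ = ‖(φ.a : ℂ)‖ := by simp
  rw [φ.norm_deriv_formula hz, ← hx, ← one_add_two_mul_re_div_one_sub hd, imCLM_apply,
    ← mul_assoc, neg_div, neg_im, mul_div_right_comm, mul_I_im]
  ring

theorem angle_two_pi (φ : DiscAut) : φ.angle (2 * Real.pi) = φ.angle 0 + 2 * Real.pi := by
  have h : circleMap 0 1 (2 * Real.pi) = circleMap 0 1 0 := (periodic_circleMap 0 1).eq
  rw [angle, angle, h]
  ring

theorem continuousOn_norm_deriv_formula (φ : DiscAut) :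
    ContinuousOn (fun z => ‖deriv φ.formula z‖) (closedBall 0 1) := fun _ hz =>
  (φ.analyticAt_formula
    (mem_closedBall_zero_iff.1 hz)).deriv.continuousAt.norm.continuousWithinAt

theorem circleAverage_comp (φ : DiscAut) {h : ℂ → ℝ} (hh : ContinuousOn h (sphere 0 1)) :
    circleAverage (fun z => ‖deriv φ.formula z‖ * h (φ.formula z)) 0 1 = circleAverage h 0 1 := by
  have hcont : Continuous fun θ => h (circleMap 0 1 θ) :=
    hh.comp_continuous (continuous_circleMap 0 1) (circleMap_mem_sphere 0 zero_le_one)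
  have hderiv : Continuous fun θ => ‖deriv φ.formula (circleMap 0 1 θ)‖ :=
    φ.continuousOn_norm_deriv_formula.comp_continuous (continuous_circleMap 0 1) fun θ =>
      circleMap_mem_closedBall 0 zero_le_one θ
  have hper : Function.Periodic (fun θ : ℝ => h (circleMap 0 1 θ)) (2 * Real.pi) := fun θ => by
    simp only [periodic_circleMap 0 1 θ]
  rw [circleAverage, circleAverage]
  congr 1
  calc ∫ θ in 0..2 * Real.pi,
        ‖deriv φ.formula (circleMap 0 1 θ)‖ * h (φ.formula (circleMap 0 1 θ))
      = ∫ θ in 0..2 * Real.pi,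
          h (circleMap 0 1 (φ.angle θ)) * ‖deriv φ.formula (circleMap 0 1 θ)‖ := by
        simp only [circleMap_angle, mul_comm]
    _ = ∫ θ in φ.angle 0..φ.angle 0 + 2 * Real.pi, h (circleMap 0 1 θ) := by
        rw [← φ.angle_two_pi]
        exact intervalIntegral.integral_comp_mul_deriv (fun θ _ => φ.hasDerivAt_angle θ)
          hderiv.continuousOn hcont
    _ = ∫ θ in 0..2 * Real.pi, h (circleMap 0 1 θ) := by
        rw [hper.intervalIntegral_add_eq (φ.angle 0) 0, zero_add]

theorem diffContOnCl_weight (p : ℝ) (φ : DiscAut) : DiffContOnCl ℂ (φ.weight p) (ball 0 1) :=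
  diffContOnCl_ball_of_differentiableAt fun _ hz => φ.differentiableAt_weight p hz

theorem circleAverage_weight_mul_dilation_le {p : ℝ} (hp : 1 ≤ p) (φ : DiscAut) {F : ℂ → ℂ}
    (hF : DifferentiableOn ℂ F (ball 0 1)) {r R : ℝ} (hr : r ∈ Set.Ico (0 : ℝ) 1)
    (hR : R ∈ Set.Ioo (0 : ℝ) 1) :
    circleAverage (fun z => ‖φ.weight p z * F (R * φ.formula z)‖ ^ p) 0 r ≤
      circleAverage (fun z => ‖F z‖ ^ p) 0 R := by
  have hp0 : 0 < p := zero_lt_one.trans_le hp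
  have hFR := diffContOnCl_dilation hF hR
  have hcont : ContinuousOn (fun z => ‖F (R * z)‖ ^ p) (sphere 0 1) := by
    refine continuousOn_norm_rpow (hFR.continuousOn.mono ?_) hp0.le
    rw [closure_ball _ one_ne_zero]
    exact sphere_subset_closedBall
  calc circleAverage (fun z => ‖φ.weight p z * F (R * φ.formula z)‖ ^ p) 0 r
      ≤ circleAverage (fun z => ‖φ.weight p z * F (R * φ.formula z)‖ ^ p) 0 1 :=
        circleAverage_norm_rpow_le_of_lt_one hp ((φ.diffContOnCl_weight p).smul
          (hFR.comp φ.diffContOnCl_formula φ.mapsTo_formula_ball)) hr.1 hr.2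
    _ = circleAverage (fun z => ‖deriv φ.formula z‖ * ‖F (R * φ.formula z)‖ ^ p) 0 1 := by
        simp only [norm_mul, Real.mul_rpow (norm_nonneg _) (norm_nonneg _),
          φ.norm_weight_rpow hp0.ne']
    _ = circleAverage (fun z => ‖F z‖ ^ p) 0 R := by
        rw [φ.circleAverage_comp hcont,
          ← circleAverage_eq_circleAverage_dilation fun z => ‖F z‖ ^ p]

theorem circleAverage_weight_mul_comp_le {p : ℝ} (hp : 1 ≤ p) (φ : DiscAut) {F : ℂ → ℂ}
    (hF : DifferentiableOn ℂ F (ball 0 1)) {A : ℝ}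
    (hA : ∀ R ∈ Set.Ioo (0 : ℝ) 1, circleAverage (fun z => ‖F z‖ ^ p) 0 R ≤ A)
    {r : ℝ} (hr : r ∈ Set.Ico (0 : ℝ) 1) :
    circleAverage (fun z => ‖φ.weight p z * F (φ.formula z)‖ ^ p) 0 r ≤ A := by
  have hball : sphere (0 : ℂ) |r| ⊆ ball 0 1 := by
    rw [abs_of_nonneg hr.1]
    exact sphere_subset_ball hr.2
  have hjoint : ContinuousOn (Function.uncurry fun (R : ℝ) z =>
      ‖φ.weight p z * F (R * φ.formula z)‖ ^ p) (Set.Icc 0 1 ×ˢ sphere 0 |r|) := by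
    have hφ : ContinuousOn (fun x : ℝ × ℂ => φ.formula x.2) (Set.Icc 0 1 ×ˢ sphere 0 |r|) :=
      φ.diffContOnCl_formula.1.continuousOn.comp continuousOn_snd fun x hx => hball hx.2
    have hw : ContinuousOn (fun x : ℝ × ℂ => φ.weight p x.2) (Set.Icc 0 1 ×ˢ sphere 0 |r|) :=
      (φ.diffContOnCl_weight p).1.continuousOn.comp continuousOn_snd fun x hx => hball hx.2
    refine continuousOn_norm_rpow (hw.mul (hF.continuousOn.comp
      (f := fun x : ℝ × ℂ => x.1 * φ.formula x.2) (.mul (by fun_prop) hφ) fun x hx => ?_))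
      (zero_le_one.trans hp)
    rw [mem_ball_zero_iff, norm_mul, norm_real, Real.norm_of_nonneg hx.1.1]
    exact mul_lt_one_of_nonneg_of_lt_one_right hx.1.2 (norm_nonneg _)
      (mem_ball_zero_iff.1 (φ.mapsTo_formula_ball (hball hx.2)))
  have hlim := ((continuousOn_circleAverage hjoint) 1 (Set.right_mem_Icc.2 zero_le_one)).mono
    Set.Ioo_subset_Icc_self
  have : (𝓝[Set.Ioo (0 : ℝ) 1] 1).NeBot := right_nhdsWithin_Ioo_neBot zero_lt_one
  simpa only [ofReal_one, one_mul] using le_of_tendsto hlim (eventually_nhdsWithin_of_forall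
    fun R hR => (φ.circleAverage_weight_mul_dilation_le hp hF hr hR).trans (hA R hR))

end DiscAut

/-! ### The Hardy space -/

theorem zeroExt_of_norm_lt_one (f : 𝔻 → ℂ) {z : ℂ} (hz : ‖z‖ < 1) :
    zeroExt f z = f (UnitDisc.mk z hz) :=
  zeroExt_coe f (UnitDisc.mk z hz)

theorem IsAnalytic.of_differentiableOn {f : 𝔻 → ℂ} {F : ℂ → ℂ}
    (hF : DifferentiableOn ℂ F (ball 0 1)) (h : ∀ z : 𝔻, f z = F z) : IsAnalytic f := by
  refine DifferentiableOn.congr hF fun z hz => ?_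
  rw [zeroExt_of_norm_lt_one f (mem_ball_zero_iff.1 hz), h, UnitDisc.coe_mk]

theorem norm_lt_one_of_mem_sphere {r : ℝ} (hr : r ∈ Set.Ioo (0 : ℝ) 1) {z : ℂ}
    (hz : z ∈ sphere 0 |r|) : ‖z‖ < 1 := by
  rw [mem_sphere_zero_iff_norm.1 hz, abs_of_pos hr.1]
  exact hr.2

theorem integralMean_eq_circleAverage {f : 𝔻 → ℂ} {F : ℂ → ℂ} (p : ℝ) (h : ∀ z : 𝔻, f z = F z)
    {r : ℝ} (hr : r ∈ Set.Ioo (0 : ℝ) 1) :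
    integralMean p f r = circleAverage (fun z => ‖F z‖ ^ p) 0 r := by
  refine Real.circleAverage_congr_sphere fun z hz => ?_
  simp only [zeroExt_of_norm_lt_one f (norm_lt_one_of_mem_sphere hr hz), h, UnitDisc.coe_mk]

theorem integralMean_le_of_norm_le {p : ℝ} (hp : 0 ≤ p) {f g : 𝔻 → ℂ} (hf : IsAnalytic f)
    (hg : IsAnalytic g) {r : ℝ} (hr : r ∈ Set.Ioo (0 : ℝ) 1)
    (h : ∀ z : 𝔻, ‖(z : ℂ)‖ = r → ‖f z‖ ≤ ‖g z‖) :
    integralMean p f r ≤ integralMean p g r := by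
  refine Real.circleAverage_mono (hf.circleIntegrable hp hr) (hg.circleIntegrable hp hr)
    fun z hz => ?_
  have hz' := norm_lt_one_of_mem_sphere hr hz
  rw [mem_sphere_zero_iff_norm, abs_of_pos hr.1] at hz
  simp only [zeroExt_of_norm_lt_one _ hz']
  exact Real.rpow_le_rpow (norm_nonneg _) (h _ hz) hp

theorem integralMean_smul (p : ℝ) (c : ℂ) (f : 𝔻 → ℂ) (r : ℝ) :
    integralMean p (c • f) r = ‖c‖ ^ p * integralMean p f r := by
  simp only [integralMean, zeroExt_smul, norm_mul, Real.mul_rpow (norm_nonneg _) (norm_nonneg _),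
    ← smul_eq_mul (‖c‖ ^ p)]
  exact Real.circleAverage_fun_smul

/-- The `p`-th power of the Hardy norm; working with it avoids the exponent `1 / p`. -/
def hpNormPow (p : ℝ) (f : 𝔻 → ℂ) : ℝ := sSup (integralMean p f '' Set.Ioo 0 1)

theorem MemHp.integralMean_le {p : ℝ} {f : 𝔻 → ℂ} (hf : MemHp p f) {r : ℝ}
    (hr : r ∈ Set.Ioo (0 : ℝ) 1) : integralMean p f r ≤ hpNormPow p f :=
  le_csSup hf.2 ⟨r, hr, rfl⟩

theorem IsAnalytic.memHp {p : ℝ} {f : 𝔻 → ℂ} (hf : IsAnalytic f) {A : ℝ}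
    (h : ∀ r ∈ Set.Ioo (0 : ℝ) 1, integralMean p f r ≤ A) : MemHp p f :=
  ⟨hf, A, Set.forall_mem_image.2 h⟩

theorem hpNormPow_le {p : ℝ} {f : 𝔻 → ℂ} {A : ℝ}
    (h : ∀ r ∈ Set.Ioo (0 : ℝ) 1, integralMean p f r ≤ A) : hpNormPow p f ≤ A :=
  csSup_le ((Set.nonempty_Ioo.2 zero_lt_one).image _) (Set.forall_mem_image.2 h)

theorem IsAnalytic.memHp_of_norm_le {p : ℝ} (hp : 0 ≤ p) {f : 𝔻 → ℂ} (hf : IsAnalytic f) {C : ℝ}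
    (h : ∀ z, ‖f z‖ ≤ C) : MemHp p f := by
  refine hf.memHp (A := C ^ p) fun r hr => ?_
  refine Real.circleAverage_mono_on_of_le_circle (hf.circleIntegrable hp hr) fun z hz => ?_
  rw [zeroExt_of_norm_lt_one _ (norm_lt_one_of_mem_sphere hr hz)]
  exact Real.rpow_le_rpow (norm_nonneg _) (h _) hp

theorem MemHp.norm_apply_zero_rpow_le {p : ℝ} (hp : 1 ≤ p) {f : 𝔻 → ℂ} (hf : MemHp p f) :
    ‖f 0‖ ^ p ≤ hpNormPow p f := by
  have hr : (1 / 2 : ℝ) ∈ Set.Ioo (0 : ℝ) 1 := by norm_num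
  have hd : DiffContOnCl ℂ (zeroExt f) (ball 0 |1 / 2|) := by
    refine (hf.1.mono ?_).diffContOnCl
    rw [abs_of_pos hr.1, closure_ball _ hr.1.ne']
    exact closedBall_subset_ball hr.2
  have h0 := norm_rpow_le_circleAverage hp hd
  rw [← UnitDisc.coe_zero, zeroExt_coe, UnitDisc.coe_zero] at h0
  exact h0.trans (hf.integralMean_le hr)

/-- A (not necessarily linear) operator that maps `H^p` into itself and preserves the norm. -/
def IsHpIsometry (p : ℝ) (T : (𝔻 → ℂ) → 𝔻 → ℂ) : Prop :=
  ∀ ⦃f⦄, MemHp p f → MemHp p (T f) ∧ hpNormPow p (T f) = hpNormPow p f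

theorem IsHpIsometry.comp {p : ℝ} {T T' : (𝔻 → ℂ) → 𝔻 → ℂ} (hT : IsHpIsometry p T)
    (hT' : IsHpIsometry p T') : IsHpIsometry p (T ∘ T') := fun _ hf =>
  ⟨(hT (hT' hf).1).1, (hT (hT' hf).1).2.trans (hT' hf).2⟩

theorem IsHpIsometry.pow {p : ℝ} {T : Module.End ℂ (𝔻 → ℂ)} (hT : IsHpIsometry p T) (n : ℕ) :
    IsHpIsometry p ⇑(T ^ n) := by
  induction n with
  | zero => exact fun f hf => ⟨hf, rfl⟩
  | succ n ih =>
    rw [pow_succ']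
    exact hT.comp ih

/-! ### The operator `U_φ` is an invertible isometry -/

theorem U_apply_eq_zeroExt (p : ℝ) (φ : DiscAut) (f : 𝔻 → ℂ) (z : 𝔻) :
    U p φ f z = φ.weight p z * zeroExt f (φ.formula z) := by
  rw [U_apply, ← DiscAut.coe_apply, zeroExt_coe]

theorem isAnalytic_U (p : ℝ) (φ : DiscAut) {f : 𝔻 → ℂ} (hf : IsAnalytic f) :
    IsAnalytic (U p φ f) :=
  .of_differentiableOn ((φ.diffContOnCl_weight p).1.mul
    (hf.comp φ.diffContOnCl_formula.1 φ.mapsTo_formula_ball)) (U_apply_eq_zeroExt p φ f)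

theorem integralMean_U_le {p : ℝ} (hp : 1 ≤ p) (φ : DiscAut) {f : 𝔻 → ℂ} (hf : MemHp p f)
    {r : ℝ} (hr : r ∈ Set.Ioo (0 : ℝ) 1) : integralMean p (U p φ f) r ≤ hpNormPow p f := by
  rw [integralMean_eq_circleAverage (F := fun z => φ.weight p z * zeroExt f (φ.formula z)) p
    (U_apply_eq_zeroExt p φ f) hr]
  exact φ.circleAverage_weight_mul_comp_le hp hf.1 (fun R hR => hf.integralMean_le hR)
    (Set.Ioo_subset_Ico_self hr)

theorem isHpIsometry_U {p : ℝ} (hp : 1 ≤ p) (φ : DiscAut) : IsHpIsometry p (U p φ) := by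
  intro f hf
  have hU : MemHp p (U p φ f) := (isAnalytic_U p φ hf.1).memHp fun r hr =>
    integralMean_U_le hp φ hf hr
  refine ⟨hU, le_antisymm (hpNormPow_le fun r hr => integralMean_U_le hp φ hf hr) ?_⟩
  have hinv : U p φ.inv (U p φ f) = f := LinearMap.congr_fun (U_inv_mul_U p φ) f
  refine hpNormPow_le fun r hr => ?_
  nth_rw 1 [← hinv]
  exact integralMean_U_le hp φ.inv hU hr

theorem MemHp.norm_apply_rpow_le {p : ℝ} (hp : 1 ≤ p) {f : 𝔻 → ℂ} (hf : MemHp p f) (z : 𝔻) :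
    (1 - ‖(z : ℂ)‖ ^ 2) * ‖f z‖ ^ p ≤ hpNormPow p f := by
  set τ := DiscAut.translation z
  obtain ⟨hU, hnorm⟩ := isHpIsometry_U hp τ hf
  have hτ0 : τ 0 = z := UnitDisc.coe_injective (DiscAut.formula_translation_zero z)
  have hderiv : ‖deriv τ.formula 0‖ = 1 - ‖(z : ℂ)‖ ^ 2 := by
    rw [τ.norm_deriv_formula (by simp), mul_zero, sub_zero, norm_one, one_pow, div_one]
    simp only [τ, DiscAut.translation, UnitDisc.coe_neg, norm_neg]
  calc (1 - ‖(z : ℂ)‖ ^ 2) * ‖f z‖ ^ p = ‖U p τ f 0‖ ^ p := by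
        rw [U_apply, hτ0, norm_mul, Real.mul_rpow (norm_nonneg _) (norm_nonneg _),
          DiscAut.norm_weight_rpow (by positivity), UnitDisc.coe_zero, hderiv]
    _ ≤ hpNormPow p (U p τ f) := hU.norm_apply_zero_rpow_le hp
    _ = hpNormPow p f := hnorm

/-! ### Multipliers of boundary modulus one -/

theorem isAnalytic_mulOp {F f : 𝔻 → ℂ} (hF : IsAnalytic F) (hf : IsAnalytic f) :
    IsAnalytic (mulOp F f) :=
  .of_differentiableOn (DifferentiableOn.mul hF hf) fun z => by
    rw [Pi.mul_apply, zeroExt_coe, zeroExt_coe]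
    rfl

theorem integralMean_mulOp_le {p : ℝ} (hp : 0 ≤ p) {F f : 𝔻 → ℂ} (hF : IsAnalytic F)
    (hF1 : ∀ z, ‖F z‖ ≤ 1) (hf : IsAnalytic f) {r : ℝ} (hr : r ∈ Set.Ioo (0 : ℝ) 1) :
    integralMean p (mulOp F f) r ≤ integralMean p f r :=
  integralMean_le_of_norm_le hp (isAnalytic_mulOp hF hf) hf hr fun z _ =>
    (norm_mul _ _).trans_le (mul_le_of_le_one_left (norm_nonneg _) (hF1 z))

theorem integralMean_le_of_integralMean_mulOp_le {p : ℝ} (hp : 1 ≤ p) {F f : 𝔻 → ℂ}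
    (hF : IsAnalytic F)
    (hlim : Tendsto (fun z => ‖F z‖) (comap (fun z : 𝔻 => ‖(z : ℂ)‖) (𝓝 1)) (𝓝 1))
    (hf : IsAnalytic f) {A : ℝ} (hA : ∀ r ∈ Set.Ioo (0 : ℝ) 1, integralMean p (mulOp F f) r ≤ A)
    {r : ℝ} (hr : r ∈ Set.Ioo (0 : ℝ) 1) : integralMean p f r ≤ A := by
  have hp0 : 0 ≤ p := zero_le_one.trans hp
  have hc : ∀ c ∈ Set.Ioo (0 : ℝ) 1, c ^ p * integralMean p f r ≤ A := by
    intro c hc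
    obtain ⟨t, hct, ht⟩ : ∃ t, (∀ z : 𝔻, ‖(z : ℂ)‖ = t → c < ‖F z‖) ∧ t ∈ Set.Ioo r 1 :=
      (((eventually_comap.1 (hlim.eventually_const_lt hc.2)).filter_mono nhdsWithin_le_nhds).and
        (Ioo_mem_nhdsLT hr.2)).exists
    have ht' : t ∈ Set.Ioo (0 : ℝ) 1 := ⟨hr.1.trans ht.1, ht.2⟩
    calc c ^ p * integralMean p f r
        ≤ c ^ p * integralMean p f t :=
          mul_le_mul_of_nonneg_left (circleAverage_norm_rpow_mono hp hf hr.1.le ht.1.le ht.2)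
            (Real.rpow_nonneg hc.1.le p)
      _ = integralMean p ((c : ℂ) • f) t := by
          rw [integralMean_smul, norm_real, Real.norm_of_nonneg hc.1.le]
      _ ≤ integralMean p (mulOp F f) t := by
          refine integralMean_le_of_norm_le hp0 ?_ (isAnalytic_mulOp hF hf) ht' fun z hz => ?_
          · exact .of_differentiableOn (hf.const_mul c) fun z => by
              rw [zeroExt_coe, Pi.smul_apply, smul_eq_mul]
          · rw [Pi.smul_apply, norm_smul, norm_real, Real.norm_of_nonneg hc.1.le]
            exact (mul_le_mul_of_nonneg_right (hct z hz).le (norm_nonneg _)).trans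
              (norm_mul _ _).ge
      _ ≤ A := hA t ht'
  have ht : Tendsto (fun c : ℝ => c ^ p * integralMean p f r) (𝓝[<] 1)
      (𝓝 (1 ^ p * integralMean p f r)) :=
    ((Real.continuousAt_rpow_const 1 p (Or.inl one_ne_zero)).mul
      continuousAt_const).mono_left nhdsWithin_le_nhds
  rw [Real.one_rpow, one_mul] at ht
  exact le_of_tendsto ht (eventually_of_mem (Ioo_mem_nhdsLT zero_lt_one) hc)

theorem isHpIsometry_mulOp {p : ℝ} (hp : 1 ≤ p) {F : 𝔻 → ℂ} (hF : IsAnalytic F)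
    (hF1 : ∀ z, ‖F z‖ ≤ 1)
    (hlim : Tendsto (fun z => ‖F z‖) (comap (fun z : 𝔻 => ‖(z : ℂ)‖) (𝓝 1)) (𝓝 1)) :
    IsHpIsometry p (mulOp F) := by
  intro f hf
  have hle : ∀ r ∈ Set.Ioo (0 : ℝ) 1, integralMean p (mulOp F f) r ≤ hpNormPow p f := fun r hr =>
    (integralMean_mulOp_le (zero_le_one.trans hp) hF hF1 hf.1 hr).trans (hf.integralMean_le hr)
  have hmem := (isAnalytic_mulOp hF hf.1).memHp hle
  exact ⟨hmem, le_antisymm (hpNormPow_le hle) (hpNormPow_le fun r hr =>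
    integralMean_le_of_integralMean_mulOp_le hp hF hlim hf.1 (fun _ => hmem.integralMean_le) hr)⟩

namespace DiscAut

theorem isAnalytic_coe (ψ : DiscAut) : IsAnalytic fun z => ψ z :=
  .of_differentiableOn ψ.diffContOnCl_formula.1 fun _ => rfl

theorem tendsto_norm_apply (ψ : DiscAut) :
    Tendsto (fun z => ‖(ψ z : ℂ)‖) (comap (fun z : 𝔻 => ‖(z : ℂ)‖) (𝓝 1)) (𝓝 1) := by
  have ha : 0 < 1 - ‖(ψ.a : ℂ)‖ := sub_pos.2 ψ.a.norm_lt_one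
  have hbound : ∀ z : 𝔻, 1 - 8 / (1 - ‖(ψ.a : ℂ)‖) * (1 - ‖(z : ℂ)‖) ≤ ‖(ψ z : ℂ)‖ := by
    intro z
    have h := ψ.inv.one_sub_norm_a_mul_one_sub_norm_le (ψ z).norm_lt_one.le
    rw [← coe_apply, inv_apply_apply, norm_coe_inv_a] at h
    rw [div_mul_eq_mul_div, sub_le_comm, le_div_iff₀' ha]
    exact h
  have hcont : Continuous fun t : ℝ => 1 - 8 / (1 - ‖(ψ.a : ℂ)‖) * (1 - t) := by fun_prop
  have hlower := (hcont.tendsto 1).comp (tendsto_comap (f := fun z : 𝔻 => ‖(z : ℂ)‖))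
  rw [sub_self, mul_zero, sub_zero] at hlower
  exact tendsto_of_tendsto_of_tendsto_of_le_of_le hlower tendsto_const_nhds hbound
    fun z => (ψ z).norm_lt_one.le

theorem exists_mulOp_eq {p : ℝ} (hp : 1 ≤ p) (ψ : DiscAut) {g : 𝔻 → ℂ} (hg : MemHp p g)
    (h0 : g ψ.a = 0) : ∃ f, MemHp p f ∧ mulOp (fun z => ψ z) f = g := by
  set q : ℂ → ℂ := fun z => dslope (zeroExt g) ψ.a z * (1 - conj (ψ.a : ℂ) * z) / ψ.lam
  set f : 𝔻 → ℂ := fun z => q z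
  have hf : IsAnalytic f := by
    refine .of_differentiableOn (F := q) (.div_const (.mul ?_ (by fun_prop)) _) fun z => rfl
    exact (differentiableOn_dslope
      (isOpen_ball.mem_nhds (mem_ball_zero_iff.2 ψ.a.norm_lt_one))).2 hg.1
  have hmul : mulOp (fun z => ψ z) f = g := by
    funext z
    have hslope := sub_smul_dslope (zeroExt g) ψ.a z
    rw [zeroExt_coe, zeroExt_coe, h0, sub_zero, smul_eq_mul] at hslope
    have hden := ψ.denominator_ne_zero z.norm_lt_one.le
    have hlam : (ψ.lam : ℂ) ≠ 0 := Circle.coe_ne_zero _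
    calc ψ.formula z * q z = (z - ψ.a) * dslope (zeroExt g) ψ.a z := by
          simp only [formula, q]
          rw [div_mul_div_comm, div_eq_iff (mul_ne_zero hden hlam)]
          ring
      _ = g z := hslope
  refine ⟨f, hf.memHp (A := hpNormPow p g) fun r hr => ?_, hmul⟩
  exact integralMean_le_of_integralMean_mulOp_le hp ψ.isAnalytic_coe ψ.tendsto_norm_apply hf
    (fun _ => hmul.symm ▸ hg.integralMean_le) hr

end DiscAut

/-! ### The operator `S` is an isometry of codimension one -/

theorem isHpIsometry_S {p : ℝ} (hp : 1 ≤ p) (ψ φ : DiscAut) : IsHpIsometry p (S p ψ φ) :=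
  (isHpIsometry_mulOp hp ψ.isAnalytic_coe (fun z => (ψ z).norm_lt_one.le)
    ψ.tendsto_norm_apply).comp (isHpIsometry_U hp φ)

theorem mem_map_S_iff {p : ℝ} (hp : 1 ≤ p) (ψ φ : DiscAut) {g : 𝔻 → ℂ} (hg : g ∈ Hp p hp) :
    g ∈ (Hp p hp).map (S p ψ φ) ↔ g ψ.a = 0 := by
  constructor
  · rintro ⟨f, -, rfl⟩
    rw [S_apply, (ψ.apply_eq_zero_iff ψ.a).2 rfl, UnitDisc.coe_zero, zero_mul]
  · intro h0
    obtain ⟨h, hh, rfl⟩ := ψ.exists_mulOp_eq hp hg h0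
    refine ⟨U p φ.inv h, (isHpIsometry_U hp φ.inv hh).1, ?_⟩
    rw [S, Module.End.mul_apply, ← Module.End.mul_apply (U p φ), U_mul_U_inv, Module.End.one_apply]

theorem isCodimOneIsometry_S {p : ℝ} (hp : 1 ≤ p) (ψ φ : DiscAut) :
    IsCodimOneIsometry p hp (S p ψ φ) := by
  refine ⟨fun f hf => ?_, ?_⟩
  · obtain ⟨hSf, hnorm⟩ := isHpIsometry_S hp ψ φ hf
    exact ⟨hSf, congrArg (· ^ (1 / p)) hnorm⟩
  · let ev : Hp p hp →ₗ[ℂ] ℂ := (LinearMap.proj ψ.a).comp (Hp p hp).subtype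
    have hker : ((Hp p hp).map (S p ψ φ)).submoduleOf (Hp p hp) = LinearMap.ker ev := by
      ext g
      exact mem_map_S_iff hp ψ φ g.2
    have hsurj : Function.Surjective ev := fun c => by
      have hconst : IsAnalytic fun _ => c :=
        .of_differentiableOn (F := fun _ => c) (differentiableOn_const c) fun _ => rfl
      exact ⟨⟨fun _ => c, hconst.memHp_of_norm_le (zero_le_one.trans hp) fun _ => le_rfl⟩, rfl⟩
    rw [hker, (ev.quotKerEquivOfSurjective hsurj).finrank_eq, Module.finrank_self]

/-! ### The intersection of the ranges of `S^n` -/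

theorem tendsto_prod_zero_of_not_summable {x : ℕ → ℝ} (h0 : ∀ k, 0 ≤ x k)
    (h1 : ∀ k, x k ≤ 1) (hx : ¬ Summable fun k => 1 - x k) :
    Tendsto (fun n => ∏ k ∈ Finset.range n, x k) atTop (𝓝 0) := by
  have ht := (not_summable_iff_tendsto_nat_atTop_of_nonneg fun k => sub_nonneg.2 (h1 k)).1 hx
  refine squeeze_zero (fun n => Finset.prod_nonneg fun k _ => h0 k) (fun n => ?_)
    (Real.tendsto_exp_neg_atTop_nhds_zero.comp ht)
  rw [Function.comp, ← Finset.sum_neg_distrib, Real.exp_sum]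
  refine Finset.prod_le_prod (fun k _ => h0 k) fun k _ => ?_
  linarith only [Real.add_one_le_exp (-(1 - x k))]

theorem not_summable_one_sub_norm_apply {χ : ℕ → DiscAut} (hχ : ¬ IsBlaschkeSeq fun k => (χ k).a)
    (z : 𝔻) : ¬ Summable fun k => 1 - ‖(χ k z : ℂ)‖ := by
  intro hs
  have hz : 0 < 1 - ‖(z : ℂ)‖ := sub_pos.2 z.norm_lt_one
  refine hχ ((hs.mul_left (8 / (1 - ‖(z : ℂ)‖))).of_nonneg_of_le
    (fun k => sub_nonneg.2 (χ k).a.norm_lt_one.le) fun k => ?_)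
  rw [div_mul_eq_mul_div, le_div_iff₀ hz]
  exact (χ k).one_sub_norm_a_mul_one_sub_norm_le z.norm_lt_one.le

theorem norm_apply_le_of_mem_map_S_pow {p : ℝ} (hp : 1 ≤ p) (ψ φ : DiscAut) {n : ℕ} {f : 𝔻 → ℂ}
    (hf : f ∈ (Hp p hp).map (S p ψ φ ^ n)) (z : 𝔻) :
    ‖f z‖ ≤ (∏ k ∈ Finset.range n, ‖(ψ.compIterate φ k z : ℂ)‖) *
      (hpNormPow p f / (1 - ‖(z : ℂ)‖ ^ 2)) ^ (1 / p) := by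
  obtain ⟨g, hg, rfl⟩ := hf
  have hp0 : 0 < p := zero_lt_one.trans_le hp
  have hz : 0 < 1 - ‖(z : ℂ)‖ ^ 2 := sub_pos.2 z.sq_norm_lt_one
  obtain ⟨hU, hUnorm⟩ := (isHpIsometry_U hp φ).pow n hg
  have hnorm : hpNormPow p ((U p φ ^ n) g) = hpNormPow p ((S p ψ φ ^ n) g) :=
    hUnorm.trans ((isHpIsometry_S hp ψ φ).pow n hg).2.symm
  have hbound : ‖(U p φ ^ n) g z‖ ≤
      (hpNormPow p ((S p ψ φ ^ n) g) / (1 - ‖(z : ℂ)‖ ^ 2)) ^ (1 / p) := by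
    rw [one_div, Real.le_rpow_inv_iff_of_pos (norm_nonneg _) ?_ hp0, le_div_iff₀' hz, ← hnorm]
    · exact hU.norm_apply_rpow_le hp z
    · rw [← hnorm]
      exact div_nonneg ((mul_nonneg hz.le (by positivity)).trans (hU.norm_apply_rpow_le hp z)) hz.le
  rw [S_pow_apply, norm_mul, norm_prod]
  exact mul_le_mul_of_nonneg_left hbound (Finset.prod_nonneg fun _ _ => norm_nonneg _)

theorem iInf_map_S_pow_eq_bot {p : ℝ} (hp : 1 ≤ p) (ψ φ : DiscAut)
    (ha : ¬ IsBlaschkeSeq fun k => (ψ.compIterate φ k).a) :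
    (⨅ n : ℕ, ⨅ _ : 1 ≤ n, (Hp p hp).map (S p ψ φ ^ n)) = ⊥ := by
  refine eq_bot_iff.2 fun f hf => (Submodule.mem_bot ℂ).2 (funext fun z => ?_)
  simp only [Submodule.mem_iInf] at hf
  have hprod := (tendsto_prod_zero_of_not_summable (fun _ => norm_nonneg _)
    (fun k => (ψ.compIterate φ k z).norm_lt_one.le)
    (not_summable_one_sub_norm_apply ha z)).mul_const
      ((hpNormPow p f / (1 - ‖(z : ℂ)‖ ^ 2)) ^ (1 / p))
  rw [zero_mul] at hprod
  exact norm_le_zero_iff.1 (ge_of_tendsto hprod ((eventually_ge_atTop 1).mono fun n hn =>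
    norm_apply_le_of_mem_map_S_pow hp ψ φ (hf n hn) z))

/-! ### Blaschke products -/

/-- The Blaschke factor with zero `a`, rotated to take the value `|a|` at `0`
(for `a = 0` it is `-z`). -/
def blaschkeFactor (a : 𝔻) : DiscAut := ⟨Circle.exp (Real.pi - arg a), a⟩

theorem blaschkeFactor_lam_mul (a : 𝔻) : ((blaschkeFactor a).lam : ℂ) * a = -‖(a : ℂ)‖ := by
  have hlam : ((blaschkeFactor a).lam : ℂ) = -Complex.exp (-(arg a * I)) := by
    rw [blaschkeFactor, Circle.coe_exp, ofReal_sub, sub_mul, sub_eq_add_neg, Complex.exp_add,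
      exp_pi_mul_I, neg_one_mul]
  calc ((blaschkeFactor a).lam : ℂ) * a
      = -Complex.exp (-(arg a * I)) * (‖(a : ℂ)‖ * Complex.exp (arg a * I)) := by
        rw [hlam, norm_mul_exp_arg_mul_I]
    _ = -(‖(a : ℂ)‖ * (Complex.exp (-(arg a * I)) * Complex.exp (arg a * I))) := by ring
    _ = -‖(a : ℂ)‖ := by rw [← Complex.exp_add, neg_add_cancel, Complex.exp_zero, mul_one]

theorem norm_blaschkeFactor_sub_one_le (a : 𝔻) {z : ℂ} (hz : ‖z‖ < 1) :
    ‖(blaschkeFactor a).formula z - 1‖ ≤ (1 + ‖z‖) / (1 - ‖z‖) * (1 - ‖(a : ℂ)‖) := by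
  set b := blaschkeFactor a
  have hba : (b.lam : ℂ) * a = -‖(a : ℂ)‖ := blaschkeFactor_lam_mul a
  have hconj : conj (a : ℂ) = -(‖(a : ℂ)‖ * b.lam) := by
    have h := congrArg conj hba
    rw [map_mul, map_neg, conj_ofReal] at h
    linear_combination (b.lam : ℂ) * h - conj (a : ℂ) * b.conj_lam_mul_lam
  have hden : 1 - conj (a : ℂ) * z ≠ 0 := b.denominator_ne_zero hz.le
  have hfactor : b.formula z - 1 =
      (b.lam * z - 1) * (1 - ‖(a : ℂ)‖ : ℝ) / (1 - conj (a : ℂ) * z) := by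
    have hb : b.formula z = b.lam * (z - a) / (1 - conj (a : ℂ) * z) := rfl
    rw [hb, sub_eq_iff_eq_add, div_add_one hden]
    congr 1
    push_cast
    linear_combination -hba + z * hconj
  have hnum : ‖b.lam * z - 1‖ ≤ 1 + ‖z‖ := by
    have h := norm_sub_le ((b.lam : ℂ) * z) 1
    rwa [norm_mul, Circle.norm_coe, one_mul, norm_one, add_comm] at h
  have hlower : 1 - ‖z‖ ≤ ‖1 - conj (a : ℂ) * z‖ := by
    have h := norm_sub_norm_le (1 : ℂ) (conj (a : ℂ) * z)
    rw [norm_one, norm_mul, RCLike.norm_conj] at h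
    linarith only [h, mul_le_of_le_one_left (norm_nonneg z) a.norm_lt_one.le]
  have ha : 0 ≤ 1 - ‖(a : ℂ)‖ := sub_nonneg.2 a.norm_lt_one.le
  have : 0 < 1 - ‖z‖ := sub_pos.2 hz
  rw [hfactor, norm_div, norm_mul, norm_real, Real.norm_of_nonneg ha, mul_div_right_comm]
  gcongr

/-- The Blaschke product of a sequence in the disc; the junk value `1` is taken where the factors
are not multipliable. -/
def blaschkeProd (a : ℕ → 𝔻) (z : ℂ) : ℂ := ∏' k, (blaschkeFactor (a k)).formula z

namespace IsBlaschkeSeq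

variable {a : ℕ → 𝔻}

theorem nat_add (ha : IsBlaschkeSeq a) (n : ℕ) : IsBlaschkeSeq fun k => a (k + n) :=
  (summable_nat_add_iff n).2 ha

theorem summable_norm_blaschkeFactor_sub_one (ha : IsBlaschkeSeq a) {z : ℂ} (hz : ‖z‖ < 1) :
    Summable fun k => ‖(blaschkeFactor (a k)).formula z - 1‖ :=
  (ha.mul_left _).of_nonneg_of_le (fun _ => norm_nonneg _)
    fun k => norm_blaschkeFactor_sub_one_le (a k) hz

theorem multipliable_blaschkeFactor (ha : IsBlaschkeSeq a) {z : ℂ} (hz : ‖z‖ < 1) :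
    Multipliable fun k => (blaschkeFactor (a k)).formula z := by
  simpa only [add_sub_cancel] using
    multipliable_one_add_of_summable (ha.summable_norm_blaschkeFactor_sub_one hz)

theorem differentiableOn_blaschkeProd_ball (ha : IsBlaschkeSeq a) {ρ : ℝ} (hρ : ρ < 1) :
    DifferentiableOn ℂ (blaschkeProd a) (ball 0 ρ) := by
  have hsub : ball (0 : ℂ) ρ ⊆ ball 0 1 := ball_subset_ball hρ.le
  have hfactor : ∀ k, DifferentiableOn ℂ (blaschkeFactor (a k)).formula (ball 0 ρ) := fun k =>
    (blaschkeFactor (a k)).diffContOnCl_formula.1.mono hsub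
  have hbound : ∀ k, ∀ z ∈ ball (0 : ℂ) ρ, ‖(blaschkeFactor (a k)).formula z - 1‖ ≤
      (1 + ρ) / (1 - ρ) * (1 - ‖(a k : ℂ)‖) := by
    intro k z hz
    have hzρ : ‖z‖ ≤ ρ := (mem_ball_zero_iff.1 hz).le
    have ha : 0 ≤ 1 - ‖(a k : ℂ)‖ := sub_nonneg.2 (a k).norm_lt_one.le
    have : 0 < 1 - ρ := sub_pos.2 hρ
    refine (norm_blaschkeFactor_sub_one_le (a k) (mem_ball_zero_iff.1 (hsub hz))).trans ?_
    have : 0 ≤ 1 + ρ := by linarith only [norm_nonneg z, hzρ]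
    gcongr
  have hprod := (ha.mul_left ((1 + ρ) / (1 - ρ))).hasProdLocallyUniformlyOn_nat_one_add
    (f := fun k z => (blaschkeFactor (a k)).formula z - 1) isOpen_ball (.of_forall hbound)
    fun k => (hfactor k).continuousOn.sub continuousOn_const
  simp only [add_sub_cancel] at hprod
  exact hprod.differentiableOn
    (.of_forall fun s => DifferentiableOn.fun_finsetProd fun k _ => hfactor k) isOpen_ball

theorem differentiableOn_blaschkeProd (ha : IsBlaschkeSeq a) :
    DifferentiableOn ℂ (blaschkeProd a) (ball 0 1) := by
  intro z hz
  obtain ⟨ρ, hzρ, hρ⟩ := exists_between (mem_ball_zero_iff.1 hz)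
  exact ((ha.differentiableOn_blaschkeProd_ball hρ).differentiableAt
    (isOpen_ball.mem_nhds (mem_ball_zero_iff.2 hzρ))).differentiableWithinAt

theorem norm_blaschkeProd_le_one (ha : IsBlaschkeSeq a) {z : ℂ} (hz : ‖z‖ < 1) :
    ‖blaschkeProd a z‖ ≤ 1 :=
  le_of_tendsto (ha.multipliable_blaschkeFactor hz).hasProd.norm (.of_forall fun _ =>
    Finset.prod_le_one (fun _ _ => norm_nonneg _)
      fun k _ => (blaschkeFactor (a k)).norm_formula_le_one hz.le)

theorem prod_range_mul_blaschkeProd_nat_add (ha : IsBlaschkeSeq a) (n : ℕ) {z : ℂ} (hz : ‖z‖ < 1) :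
    (∏ k ∈ Finset.range n, (blaschkeFactor (a k)).formula z) *
      blaschkeProd (fun k => a (k + n)) z = blaschkeProd a z :=
  Multipliable.prod_mul_tprod_nat_mul' (f := fun k => (blaschkeFactor (a k)).formula z)
    ((ha.nat_add n).multipliable_blaschkeFactor hz)

theorem blaschkeProd_ne_zero (ha : IsBlaschkeSeq a) {z : 𝔻} (hz : ∀ k, z ≠ a k) :
    blaschkeProd a z ≠ 0 := by
  have h := tprod_one_add_ne_zero_of_summable
    (f := fun k => (blaschkeFactor (a k)).formula z - 1) (fun k => ?_)
    (ha.summable_norm_blaschkeFactor_sub_one z.norm_lt_one)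
  · simpa only [add_sub_cancel, blaschkeProd] using h
  · rw [add_sub_cancel, ← DiscAut.coe_apply, Ne, UnitDisc.coe_eq_zero, DiscAut.apply_eq_zero_iff]
    exact hz k

theorem exists_blaschkeProd_ne_zero (ha : IsBlaschkeSeq a) : ∃ z : 𝔻, blaschkeProd a z ≠ 0 := by
  obtain ⟨w, hw, hball⟩ := ((Set.countable_range fun k => (a k : ℂ)).dense_compl ℝ).exists_mem_open
    isOpen_ball (nonempty_ball.2 (zero_lt_one' ℝ) : (ball (0 : ℂ) 1).Nonempty)
  refine ⟨UnitDisc.mk w (mem_ball_zero_iff.1 hball), ha.blaschkeProd_ne_zero fun k h => hw ⟨k, ?_⟩⟩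
  exact (congrArg UnitDisc.coe h).symm

theorem isAnalytic_blaschkeProd (ha : IsBlaschkeSeq a) : IsAnalytic fun z => blaschkeProd a z :=
  .of_differentiableOn ha.differentiableOn_blaschkeProd fun _ => rfl

theorem memHp_blaschkeProd (ha : IsBlaschkeSeq a) {p : ℝ} (hp : 0 ≤ p) :
    MemHp p fun z => blaschkeProd a z :=
  ha.isAnalytic_blaschkeProd.memHp_of_norm_le hp fun z => ha.norm_blaschkeProd_le_one z.norm_lt_one

end IsBlaschkeSeq

theorem blaschkeFactor_formula (χ : DiscAut) (z : ℂ) :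
    (blaschkeFactor χ.a).formula z = (blaschkeFactor χ.a).lam / χ.lam * χ.formula z := by
  have hlam : (χ.lam : ℂ) ≠ 0 := Circle.coe_ne_zero _
  rw [DiscAut.formula, DiscAut.formula, mul_div_assoc, mul_div_assoc, ← mul_assoc,
    div_mul_cancel₀ _ hlam]
  rfl

theorem blaschkeProd_mem_map_S_pow {p : ℝ} (hp : 1 ≤ p) (ψ φ : DiscAut)
    (ha : IsBlaschkeSeq fun k => (ψ.compIterate φ k).a) (n : ℕ) :
    (fun z : 𝔻 => blaschkeProd (fun k => (ψ.compIterate φ k).a) z) ∈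
      (Hp p hp).map (S p ψ φ ^ n) := by
  set χ := ψ.compIterate φ
  set c : ℂ := ∏ k ∈ Finset.range n, ((blaschkeFactor (χ k).a).lam / (χ k).lam : ℂ)
  set tail : 𝔻 → ℂ := fun z => blaschkeProd (fun k => (χ (k + n)).a) z
  have htail : tail ∈ Hp p hp := (ha.nat_add n).memHp_blaschkeProd (zero_le_one.trans hp)
  have hcancel : U p φ ^ n * U p φ.inv ^ n = 1 := pow_mul_pow_eq_one n (U_mul_U_inv p φ)
  set g := (U p φ.inv ^ n) (c • tail)
  have hUg : (U p φ ^ n) g = c • tail := LinearMap.congr_fun hcancel _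
  refine ⟨g, ((isHpIsometry_U hp φ.inv).pow n ((Hp p hp).smul_mem _ htail)).1, funext fun z => ?_⟩
  calc (S p ψ φ ^ n) g z
      = (∏ k ∈ Finset.range n, (blaschkeFactor (χ k).a).formula z) * tail z := by
        simp only [S_pow_apply, hUg, blaschkeFactor_formula, Finset.prod_mul_distrib,
          Pi.smul_apply, smul_eq_mul, DiscAut.coe_apply]
        ring
    _ = blaschkeProd (fun k => (χ k).a) z :=
        ha.prod_range_mul_blaschkeProd_nat_add n z.norm_lt_one

theorem iInf_map_S_pow_ne_bot {p : ℝ} (hp : 1 ≤ p) (ψ φ : DiscAut)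
    (ha : IsBlaschkeSeq fun k => (ψ.compIterate φ k).a) :
    (⨅ n : ℕ, ⨅ _ : 1 ≤ n, (Hp p hp).map (S p ψ φ ^ n)) ≠ ⊥ := by
  obtain ⟨w, hw⟩ := ha.exists_blaschkeProd_ne_zero
  refine (Submodule.ne_bot_iff _).2 ⟨fun z => blaschkeProd _ z, ?_, fun h => hw (congrFun h w)⟩
  simp only [Submodule.mem_iInf]
  exact fun n _ => blaschkeProd_mem_map_S_pow hp ψ φ ha n

end HardyIsometry

end

theorem theorem2 (p : ℝ) (hp : 1 ≤ p) (φ ψ : HardyIsometry.DiscAut) :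
    HardyIsometry.IsCodimOneIsometry p hp (HardyIsometry.S p ψ φ) ∧
    ∃ a : ℕ → Complex.UnitDisc, (∀ (k : ℕ) (w : Complex.UnitDisc), ψ (φ^[k] w) = 0 ↔ w = a k) ∧
      (HardyIsometry.IsCrownover p hp (HardyIsometry.S p ψ φ) ↔
        ¬ HardyIsometry.IsBlaschkeSeq a) := by
  have hS := HardyIsometry.isCodimOneIsometry_S hp ψ φ
  refine ⟨hS, fun k => (ψ.compIterate φ k).a, fun k w => ?_, fun h hB => ?_, fun h => ⟨hS, ?_⟩⟩
  · rw [← HardyIsometry.DiscAut.compIterate_apply, HardyIsometry.DiscAut.apply_eq_zero_iff]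
  · exact HardyIsometry.iInf_map_S_pow_ne_bot hp ψ φ hB h.2
  · exact HardyIsometry.iInf_map_S_pow_eq_bot hp ψ φ h
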